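/- **Theorem (Correctness and termination of MinQP_LOF).** Let $\mathbb F$ be a linearly ordered field. An instance of dimension $n$ consists of $\mathsf P=(A,b)$ with $A\in\mathbb F^{m\times n}$, $b\in\mathbb F^m$ (zero rows of $A$ are allowed) and $\mathsf f=(Q,c,\gamma)$ with $Q\in\mathbb F^{n\times n}$, $c\in\mathbb F^n$, $\gamma\in\mathbb F$. It represents the polyhedron $P=\{x\in\mathbb F^n: Ax\le b\}$ and the function $f(x)=x^TQx+c^Tx+\gamma$. Programs are built from the constants $0,1$, the four field operations (division by $0$ is an error), branching on $x\le y$, and recursive calls; each executed instruction counts as one step. Consider the recursive procedure $\mathrm{MinQP\_LOF}(\mathsf P,\mathsf f)$: 1. *(Preprocessing)* For each row with $a_i=0$: if $b_i<0$, return Infeasible; otherwise remove the row. 2. *(Base case)* If $n=1$, solve the univariate problem directly and return its result. 3. *(Diagonalization)* After replacing $Q$ by $\tfrac12(Q+Q^T)$ (no change if $Q$ is symmetric), compute an invertible $S$ (and $S^{-1}$), a diagonal $\Lambda$, vectors $v,u$ and a scalar $\gamma'$ with $\Lambda u=0$ and $f(x)=(x-v)^TS^T\Lambda S(x-v)+u^TS(x-v)+\gamma'$.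 Pass to the coordinates $y=S(x-v)$; the constraints become $(AS^{-1})y\le b-Av$, and these are again denoted $Ay\le b$. 4. *(Global optimality check)* If $\Lambda\succeq0$, $u=0$ and $0\le b$, return (Optimal, $\gamma'$, $v$). 5. *(Branching)* Start with an empty set $\mathcal S$ of candidates. For every $h\in\{-1,1\}^n$ form the system $\mathsf P^h$ consisting of $Ay\le b$ and $\operatorname{diag}(h)\,y\le 0$. For every inequality $a_k^Ty\le b_k$ of $\mathsf P^h$, compute $M\in\mathbb F^{n\times(n-1)}$ and $p\in\mathbb F^n$ such that $y=Mz+p$ parameterizes the hyperplane $a_k^Ty=b_k$, substitute $y=Mz+p$ into the objective and into the remaining inequalities of $\mathsf P^h$, and call the procedure recursively on this $(n-1)$-dimensional instance. If the call returns Unbounded, return Unbounded; if it returns (Optimal, $val$, $z^*$), add $(val, Mz^*+p)$ to $\mathcal S$. 6. *(Final selection)* If $\mathcal S=\emptyset$, return Infeasible. Otherwise choose $(val^*,y^*)\in\mathcal S$ with minimal $val^*$ and return (Optimal, $val^*$, $S^{-1}y^*+v$). Three subroutines are specified here only by what they have to compute: the decoupled diagonal form (of a function with symmetric matrix), the parameterization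 of a hyperplane with non-zero normal vector, and the solution of a univariate instance without zero rows. Then: (a) The standard implementations of these subroutines (Lagrange diagonalization with completion of squares; solving for a coordinate with non-zero coefficient; interval computation) consist of the above instructions without recursive calls, and on every admissible input over $\mathbb F$ they halt without error and meet their specification. (b) For every choice of subroutines that halt without recursive calls and meet their specification, and for every instance $(\mathsf P,\mathsf f)$ over $\mathbb F$ of any size $m,n\ge0$, the procedure $\mathrm{MinQP\_LOF}$ terminates without error after finitely many steps, and it returns - *Infeasible* if and only if $P=\emptyset$; - *Unbounded* if and only if $f$ is unbounded from below on $P$, that is, for every $\varepsilon\in\mathbb F$ there is $x\in P$ with $f(x)<\varepsilon$; - *Optimal* together with a value and a point $x^*$ if and only if $f$ has a global minimum on $P$; in this case $x^*\in P$, the value is $f(x^*)$, and $f(x^*)\le f(x)$ for all $x\in P$. -/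

import Mathlib

universe u v

namespace QP

/-! ## Data structures

`V` is the type of scalars. Nothing in the definition of the algorithm assumes any structure on `V`:
scalars can be manipulated only through the primitive instructions of `QP.Prog` below. -/

/-- The data `(Q, c, γ)` of the quadratic function `x ↦ xᵀ Q x + cᵀ x + γ`. -/
structure Objective (V : Type u) (n : ℕ) where
  Q : Matrix (Fin n) (Fin n) V
  c : Fin n → V
  γ : V

/-- One row `aᵀ x ≤ b` of a system of linear inequalities. -/
structure Constraint (V : Type u) (n : ℕ) where
  a : Fin n → V
  b : V

/-- An instance: a finite system of linear inequalities and an objective. -/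
structure Problem (V : Type u) (n : ℕ) where
  cons : List (Constraint V n)
  obj : Objective V n

/-- The instance given by the system `A x ≤ b` and the objective `(Q, c, γ)`. -/
def Problem.ofMatrix {V : Type u} {m n : ℕ} (A : Matrix (Fin m) (Fin n) V) (b : Fin m → V)
    (Q : Matrix (Fin n) (Fin n) V) (c : Fin n → V) (γ : V) : Problem V n where
  cons := List.ofFn fun i => ⟨A i, b i⟩
  obj := ⟨Q, c, γ⟩

/-- The returned triple (status, value, point). The value is `∞` for `infeasible` and `-∞` for
`unbounded`, and in both of these cases there is no point, so only `optimal` carries data. -/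
inductive Result (V : Type u) (n : ℕ) : Type u
  | infeasible : Result V n
  | unbounded : Result V n
  | optimal (value : V) (point : Fin n → V) : Result V n

/-- The affine map `z ↦ M z + p` from `k`-space to `n`-space. -/
structure Substitution (V : Type u) (n k : ℕ) where
  M : Matrix (Fin n) (Fin k) V
  p : Fin n → V

/-- The data of a decoupled diagonal form
`f x = (x - v)ᵀ Sᵀ Λ S (x - v) + uᵀ S (x - v) + γ`, together with the inverse of `S`.
The diagonal matrix `Λ` is stored as the vector of its diagonal entries. -/
structure Decomposition (V : Type u) (n : ℕ) where
  S : Matrix (Fin n) (Fin n) V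
  Sinv : Matrix (Fin n) (Fin n) V
  v : Fin n → V
  Λ : Fin n → V
  u : Fin n → V
  γ : V

/-! ## Programs over an ordered field

Programs in the style of Blum, Shub and Smale: the primitive instructions are the constants `0` and
`1`, the four field operations, and branching on `x ≤ y`. In addition there is an instruction for a
recursive call of the (single) procedure on another instance. -/

/-- The four field operations. -/
inductive Op
  | add | sub | mul | div

/-- Programs on scalars from `V` that return an element of `α`. -/
inductive Prog (V : Type u) (α : Type v) : Type (max u v)
  | ret (a : α) : Prog V α
  | constZero (k : V → Prog V α) : Prog V α
  | constOne (k : V → Prog V α) : Prog V α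
  | arith (o : Op) (x y : V) (k : V → Prog V α) : Prog V α
  | ifLE (x y : V) (yes no : Prog V α) : Prog V α
  | call {n : ℕ} (P : Problem V n) (k : Result V n → Prog V α) : Prog V α

namespace Prog

/-- Sequential composition. -/
def bind {V : Type u} {α β : Type v} : Prog V α → (α → Prog V β) → Prog V β
  | ret a, g => g a
  | constZero k, g => constZero fun x => (k x).bind g
  | constOne k, g => constOne fun x => (k x).bind g
  | arith o x y k, g => arith o x y fun z => (k z).bind g
  | ifLE x y yes no, g => ifLE x y (yes.bind g) (no.bind g)
  | call P k, g => call P fun r => (k r).bind g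

instance {V : Type u} : Monad (Prog V : Type u → Type u) where
  pure := ret
  bind := bind

variable {V : Type u}

def zero : Prog V V := constZero ret
def one : Prog V V := constOne ret
def add (x y : V) : Prog V V := arith .add x y ret
def sub (x y : V) : Prog V V := arith .sub x y ret
def mul (x y : V) : Prog V V := arith .mul x y ret
def div (x y : V) : Prog V V := arith .div x y ret
def neg (x : V) : Prog V V := do let z ← zero; sub z x

/-- Recursive call of the procedure. -/
def recurse {n : ℕ} (P : Problem V n) : Prog V (Result V n) := call P ret

/-- The outcome of the comparison `x ≤ y`. -/
def leTest (x y : V) : Prog V (ULift.{u} Bool) := ifLE x y (ret ⟨true⟩) (ret ⟨false⟩)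

/-- The outcome of the comparison `x = 0`. -/
def zeroTest (x : V) : Prog V (ULift.{u} Bool) := do
  let z ← zero
  ifLE x z (ifLE z x (ret ⟨true⟩) (ret ⟨false⟩)) (ret ⟨false⟩)

/-- Whether the test succeeds for all members of the list. -/
def allTest {β : Type} (test : β → Prog V (ULift.{u} Bool)) : List β → Prog V (ULift.{u} Bool)
  | [] => ret ⟨true⟩
  | x :: l => do
    if (← test x).down then allTest test l else ret ⟨false⟩

/-- Run the programs `f 0`, `f 1`, … and collect the results in a vector. -/
def vec {β : Type u} : {n : ℕ} → (Fin n → Prog V β) → Prog V (Fin n → β)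
  | 0, _ => ret Fin.elim0
  | _ + 1, f => do
    let x ← f 0
    let xs ← vec fun i => f i.succ
    ret (Fin.cons x xs)

/-- Run the programs `f i j` and collect the results in a matrix. -/
def mat {m n : ℕ} (f : Fin m → Fin n → Prog V V) : Prog V (Matrix (Fin m) (Fin n) V) := do
  let rows ← vec fun i => vec (f i)
  ret (Matrix.of rows)

/-- Run a program on every member of a list. -/
def mapList {α β : Type u} (f : α → Prog V β) : List α → Prog V (List β)
  | [] => ret []
  | a :: l => do
    let x ← f a
    let xs ← mapList f l
    ret (x :: xs)

/-- The sum of the results of `f 0`, `f 1`, …. -/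
def sum : {n : ℕ} → (Fin n → Prog V V) → Prog V V
  | 0, _ => zero
  | _ + 1, f => do
    let x ← f 0
    let s ← sum fun i => f i.succ
    add x s

/-- `xᵀ y`. -/
def dot {n : ℕ} (x y : Fin n → V) : Prog V V := sum fun i => mul (x i) (y i)

end Prog

open Prog

section Algorithm

variable {V : Type u}

/-! ## Substitutions -/

/-- `M z + p`. -/
def Substitution.apply {n k : ℕ} (σ : Substitution V n k) (z : Fin k → V) : Prog V (Fin n → V) :=
  vec fun i => do add (← dot (σ.M i) z) (σ.p i)

/-- Substitute `x = M z + p` in `aᵀ x ≤ b`: the result is `(Mᵀ a)ᵀ z ≤ b - aᵀ p`. -/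
def Constraint.subst {n k : ℕ} (σ : Substitution V n k) (r : Constraint V n) :
    Prog V (Constraint V k) := do
  let a ← vec fun j => dot r.a fun i => σ.M i j
  let b ← sub r.b (← dot r.a σ.p)
  ret ⟨a, b⟩

/-- Substitute `x = M z + p` in `xᵀ Q x + cᵀ x + γ`: the result has the matrix `Mᵀ Q M`, the linear
term `Mᵀ (Q p + Qᵀ p + c)` and the constant `pᵀ (Q p) + cᵀ p + γ`. -/
def Objective.subst {n k : ℕ} (σ : Substitution V n k) (f : Objective V n) :
    Prog V (Objective V k) := do
  let QM ← mat fun i j => dot (f.Q i) fun l => σ.M l j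
  let Q ← mat fun i j => dot (fun l => σ.M l i) fun l => QM l j
  let Qp ← vec fun i => dot (f.Q i) σ.p
  let Qtp ← vec fun i => dot (fun l => f.Q l i) σ.p
  let g ← vec fun i => do add (← add (Qp i) (Qtp i)) (f.c i)
  let c ← vec fun j => dot (fun i => σ.M i j) g
  let γ ← add (← add (← dot σ.p Qp) (← dot f.c σ.p)) f.γ
  ret ⟨Q, c, γ⟩

/-! ## The algorithm

Three steps are specified by what they have to compute and not by how they do it. They are
parameters of the algorithm; see `Subroutines.MeetsSpec` for what is required of them, and
`standardSubroutines` for an explicit implementation. -/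

/-- The subroutines: computing a decoupled diagonal form, parameterizing a hyperplane
`aᵀ y = b`, and solving a one-dimensional instance. -/
structure Subroutines (V : Type u) where
  diagonalize : {n : ℕ} → Objective V n → Prog V (Decomposition V n)
  parameterize : {n : ℕ} → Constraint V n → Prog V (Substitution V n (n - 1))
  solveUnivariate : Problem V 1 → Prog V (Result V 1)

/-- Preprocessing: drop the rows with `a = 0` and `b ≥ 0`; answer `none` (infeasible) if there is a
row with `a = 0` and `b < 0`. -/
def dropZeroRows {n : ℕ} : List (Constraint V n) → Prog V (Option (List (Constraint V n)))
  | [] => ret (some [])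
  | r :: l => do
    if (← allTest (fun i => zeroTest (r.a i)) (List.finRange n)).down then
      let z ← zero
      if (← leTest z r.b).down then dropZeroRows l else ret none
    else
      match ← dropZeroRows l with
      | none => ret none
      | some l' => ret (some (r :: l'))

/-- Replace `Q` by `(Q + Qᵀ) / 2`, which represents the same function (and is `Q` itself if `Q` is
symmetric). -/
def symmetrize {n : ℕ} (f : Objective V n) : Prog V (Objective V n) := do
  let o ← one
  let two ← add o o
  let Q ← mat fun i j => do div (← add (f.Q i j) (f.Q j i)) two
  ret ⟨Q, f.c, f.γ⟩

/-- The objective `yᵀ Λ y + uᵀ y + γ` of the diagonalized problem. -/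
def Decomposition.objective {n : ℕ} (D : Decomposition V n) : Prog V (Objective V n) := do
  let z ← zero
  ret ⟨Matrix.of fun i j => if i = j then D.Λ i else z, D.u, D.γ⟩

/-- The test `Λ ≥ 0`, `u = 0` and `0 ≤ b`. -/
def globalTest {n : ℕ} (D : Decomposition V n) (cons : List (Constraint V n)) :
    Prog V (ULift.{u} Bool) := do
  let z ← zero
  if (← allTest (fun i => leTest z (D.Λ i)) (List.finRange n)).down then
    if (← allTest (fun i => zeroTest (D.u i)) (List.finRange n)).down then
      allTest (fun i : Fin cons.length => leTest z (cons.get i).b) (List.finRange cons.length)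
    else ret ⟨false⟩
  else ret ⟨false⟩

/-- All sign vectors `h ∈ {-1, 1}ⁿ`; `true` stands for `1` and `false` for `-1`. -/
def signVectors : (n : ℕ) → List (Fin n → Bool)
  | 0 => [Fin.elim0]
  | n + 1 => (signVectors n).flatMap fun h => [Fin.cons true h, Fin.cons false h]

/-- The rows `hᵢ yᵢ ≤ 0` of `diag(h) y ≤ 0`. -/
def orthantRows {n : ℕ} (h : Fin n → Bool) : Prog V (List (Constraint V n)) := do
  let z ← zero
  let o ← one
  let o' ← neg o
  ret ((List.finRange n).map fun i =>
    ⟨fun j => if j = i then (if h i then o else o') else z, z⟩)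

/-- Every member of a list, paired with the list of the remaining members. -/
def picks {α : Type u} : List α → List (α × List α)
  | [] => []
  | a :: l => (a, l) :: (picks l).map fun q => (q.1, a :: q.2)

/-- The inner loop, over the formal facets: each of them is projected to dimension `n - 1` and
solved by a recursive call. The answer `none` means that a recursive call returned `unbounded`;
otherwise the candidates found are added to `cand`. -/
def facetLoop (R : Subroutines V) {n : ℕ} (f : Objective V n) :
    List (Constraint V n × List (Constraint V n)) → List (V × (Fin n → V)) →
      Prog V (Option (List (V × (Fin n → V))))
  | [], cand => ret (some cand)
  | (row, rest) :: l, cand => do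
    let σ ← R.parameterize row
    let cons ← mapList (Constraint.subst σ) rest
    let g ← f.subst σ
    match ← recurse ⟨cons, g⟩ with
    | .unbounded => ret none
    | .infeasible => facetLoop R f l cand
    | .optimal val z => do
      let y ← σ.apply z
      facetLoop R f l ((val, y) :: cand)

/-- The outer loop, over the orthants. -/
def orthantLoop (R : Subroutines V) {n : ℕ} (f : Objective V n) (cons : List (Constraint V n)) :
    List (Fin n → Bool) → List (V × (Fin n → V)) → Prog V (Option (List (V × (Fin n → V))))
  | [], cand => ret (some cand)
  | h :: l, cand => do
    let rows ← orthantRows h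
    match ← facetLoop R f (picks (cons ++ rows)) cand with
    | none => ret none
    | some cand' => orthantLoop R f cons l cand'

/-- A candidate of minimum value among `best` and the members of the list. -/
def selectMin {n : ℕ} (best : V × (Fin n → V)) :
    List (V × (Fin n → V)) → Prog V (V × (Fin n → V))
  | [] => ret best
  | q :: l => do
    if (← leTest best.1 q.1).down then selectMin best l else selectMin q l

/-- Diagonalization, global optimality check, branching and final selection. -/
def solveMultivariate (R : Subroutines V) {n : ℕ} (P : Problem V n) : Prog V (Result V n) := do
  let D ← R.diagonalize (← symmetrize P.obj)
  let cons ← mapList (Constraint.subst ⟨D.Sinv, D.v⟩) P.cons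
  let f ← D.objective
  if (← globalTest D cons).down then
    ret (.optimal D.γ D.v)
  else
    match ← orthantLoop R f cons (signVectors n) [] with
    | none => ret .unbounded
    | some [] => ret .infeasible
    | some (q :: l) => do
      let best ← selectMin q l
      let x ← Substitution.apply ⟨D.Sinv, D.v⟩ best.2
      ret (.optimal best.1 x)

/-- The case distinction on the dimension. -/
def solveReduced (R : Subroutines V) : {n : ℕ} → Problem V n → Prog V (Result V n)
  | 1, P => R.solveUnivariate P
  | _, P => solveMultivariate R P

/-- The body of the recursive procedure `MinQP_LOF`. -/
def minQP (R : Subroutines V) {n : ℕ} (P : Problem V n) : Prog V (Result V n) := do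
  match ← dropZeroRows P.cons with
  | none => ret .infeasible
  | some cons => solveReduced R ⟨cons, P.obj⟩

/-! ## An explicit implementation of the subroutines -/

/-- State of the diagonalization: `T` and `S` are inverse to each other and `D = Tᵀ Q T`. -/
structure DiagState (V : Type u) (n : ℕ) where
  T : Matrix (Fin n) (Fin n) V
  S : Matrix (Fin n) (Fin n) V
  D : Matrix (Fin n) (Fin n) V

/-- Add `α` times the column `j` of `T` to the column `i`, and adjust `S` and `D`. -/
def DiagState.addCol {n : ℕ} (s : DiagState V n) (i j : Fin n) (α : V) :
    Prog V (DiagState V n) := do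
  let T ← mat fun a b => do
    if b = i then add (s.T a b) (← mul α (s.T a j)) else ret (s.T a b)
  let S ← mat fun a b => do
    if a = j then sub (s.S a b) (← mul α (s.S i b)) else ret (s.S a b)
  let D₁ ← mat fun a b => do
    if b = i then add (s.D a b) (← mul α (s.D a j)) else ret (s.D a b)
  let D₂ ← mat fun a b => do
    if a = i then add (D₁ a b) (← mul α (D₁ j b)) else ret (D₁ a b)
  ret ⟨T, S, D₂⟩

/-- The first member of the list for which the entry `w i` is non-zero. -/
def firstNonzero {n : ℕ} (w : Fin n → V) : List (Fin n) → Prog V (Option (ULift.{u} (Fin n)))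
  | [] => ret none
  | i :: l => do
    if (← zeroTest (w i)).down then firstNonzero w l else ret (some ⟨i⟩)

/-- Make `D k k` non-zero, unless the row `k` of `D` is zero from the diagonal on. -/
def DiagState.fixPivot {n : ℕ} (s : DiagState V n) (k : Fin n) : Prog V (DiagState V n) := do
  if (← zeroTest (s.D k k)).down then
    match ← firstNonzero (s.D k) ((List.finRange n).filter fun j => k < j) with
    | none => ret s
    | some j => do
      let o ← one
      let s' ← s.addCol k j.down o
      if (← zeroTest (s'.D k k)).down then s.addCol k j.down (← neg o) else ret s'
  else ret s

/-- Clear the entries of the row `k` of `D` with the given column indices, using the pivot. -/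
def DiagState.clearRow {n : ℕ} (k : Fin n) : DiagState V n → List (Fin n) → Prog V (DiagState V n)
  | s, [] => ret s
  | s, j :: l => do
    let α ← neg (← div (s.D k j) (s.D k k))
    DiagState.clearRow k (← s.addCol j k α) l

/-- Lagrange diagonalization by symmetric elementary operations. -/
def DiagState.lagrange {n : ℕ} : DiagState V n → List (Fin n) → Prog V (DiagState V n)
  | s, [] => ret s
  | s, k :: l => do
    let s' ← s.fixPivot k
    if (← zeroTest (s'.D k k)).down then DiagState.lagrange s' l
    else DiagState.lagrange (← DiagState.clearRow k s' ((List.finRange n).filter fun j => k < j)) l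

/-- Complete the square in `lam * t ^ 2 + c * t`: returns the center, the remaining linear
coefficient, and the constant to subtract. -/
def completeSquare (lam c : V) : Prog V (V × V × V) := do
  let z ← zero
  if (← zeroTest lam).down then ret (z, c, z)
  else
    let two_lam ← add lam lam
    let w ← neg (← div c two_lam)
    let g ← div (← mul c c) (← add two_lam two_lam)
    ret (w, z, g)

/-- The decoupled diagonal form of a quadratic function with symmetric matrix. -/
def decoupledForm {n : ℕ} (f : Objective V n) : Prog V (Decomposition V n) := do
  let z ← zero
  let o ← one
  let I : Matrix (Fin n) (Fin n) V := Matrix.of fun i j => if i = j then o else z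
  let s ← DiagState.lagrange ⟨I, I, f.Q⟩ (List.finRange n)
  let c ← vec fun i => dot (fun a => s.T a i) f.c
  let w ← vec fun i => completeSquare (s.D i i) (c i)
  let v ← vec fun i => dot (s.T i) fun j => (w j).1
  let g ← sum fun i => ret (w i).2.2
  let γ ← sub f.γ g
  ret ⟨s.S, s.T, v, fun i => s.D i i, fun i => (w i).2.1, γ⟩

/-- Parameterize the hyperplane `aᵀ y = b` by solving for a coordinate with a non-zero coefficient;
the result is irrelevant if there is none. -/
def solveForCoordinate : {n : ℕ} → Constraint V n → Prog V (Substitution V n (n - 1))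
  | 0, _ => ret ⟨Matrix.of fun i _ => i.elim0, fun i => i.elim0⟩
  | n + 1, r => do
    let z ← zero
    let o ← one
    match ← firstNonzero r.a (List.finRange (n + 1)) with
    | none => ret ⟨Matrix.of fun _ _ => z, fun _ => z⟩
    | some j => do
      let w ← vec fun l : Fin n => do neg (← div (r.a (j.down.succAbove l)) (r.a j.down))
      let t ← div r.b (r.a j.down)
      ret ⟨Matrix.of fun i l =>
          if i = j.down then w l else if i = j.down.succAbove l then o else z,
        fun i => if i = j.down then t else z⟩

/-- The bounds `lo ≤ t ≤ hi` (`none` if absent) defined by one-dimensional rows `a t ≤ b` with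
`a ≠ 0`, in addition to the given ones. -/
def intervalBounds : List (Constraint V 1) → Option V → Option V → Prog V (Option V × Option V)
  | [], lo, hi => ret (lo, hi)
  | r :: l, lo, hi => do
    let z ← zero
    let t ← div r.b (r.a 0)
    if (← leTest z (r.a 0)).down then
      match hi with
      | none => intervalBounds l lo (some t)
      | some s =>
        if (← leTest s t).down then intervalBounds l lo (some s)
        else intervalBounds l lo (some t)
    else
      match lo with
      | none => intervalBounds l (some t) hi
      | some s =>
        if (← leTest t s).down then intervalBounds l (some s) hi
        else intervalBounds l (some t) hi

/-- The value `q t² + c t + γ`, returned together with `t` as an optimal solution. -/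
def optimalAt (f : Objective V 1) (t : V) : Prog V (Result V 1) := do
  let val ← add (← mul (← add (← mul (f.Q 0 0) t) (f.c 0)) t) f.γ
  ret (.optimal val fun _ => t)

/-- The better one of two points. -/
def betterOf (f : Objective V 1) (s t : V) : Prog V (Result V 1) := do
  let fs ← add (← mul (← add (← mul (f.Q 0 0) s) (f.c 0)) s) f.γ
  let ft ← add (← mul (← add (← mul (f.Q 0 0) t) (f.c 0)) t) f.γ
  if (← leTest fs ft).down then ret (.optimal fs fun _ => s) else ret (.optimal ft fun _ => t)

/-- Minimize over a non-empty interval. -/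
def solveInterval (f : Objective V 1) (lo hi : Option V) : Prog V (Result V 1) := do
  let z ← zero
  let q := f.Q 0 0
  let c := f.c 0
  if (← leTest q z).down then
    if (← leTest z q).down then
      -- the linear case
      if (← leTest c z).down then
        if (← leTest z c).down then
          match lo, hi with
          | some s, _ => optimalAt f s
          | none, some t => optimalAt f t
          | none, none => optimalAt f z
        else
          match hi with
          | some t => optimalAt f t
          | none => ret .unbounded
      else
        match lo with
        | some s => optimalAt f s
        | none => ret .unbounded
    else
      -- the strictly concave case
      match lo, hi with
      | some s, some t => betterOf f s t
      | _, _ => ret .unbounded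
  else
    -- the strictly convex case: project the vertex to the interval
    let x ← neg (← div c (← add q q))
    let x₁ ← (match lo with
      | none => ret x
      | some s => do if (← leTest s x).down then ret x else ret s)
    let x₂ ← (match hi with
      | none => ret x₁
      | some t => do if (← leTest x₁ t).down then ret x₁ else ret t)
    optimalAt f x₂

/-- Solve a one-dimensional instance all of whose rows are non-zero. -/
def solveLine (P : Problem V 1) : Prog V (Result V 1) := do
  let B ← intervalBounds P.cons none none
  match B.1, B.2 with
  | some s, some t => do
    if (← leTest s t).down then solveInterval P.obj (some s) (some t) else ret .infeasible
  | lo, hi => solveInterval P.obj lo hi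

variable (V) in
/-- Lagrange diagonalization, elimination of a coordinate, and interval arithmetic. -/
def standardSubroutines : Subroutines V where
  diagonalize := decoupledForm
  parameterize := solveForCoordinate
  solveUnivariate := solveLine

end Algorithm

/-! ## Execution over an ordered field -/

section Execution

variable {F : Type u} [Field F] [LinearOrder F]

/-- Count one step. -/
def tick {α : Type v} (o : Option (α × ℕ)) : Option (α × ℕ) := o.map fun q => (q.1, q.2 + 1)

/-- Run a program on scalars from `F`; `handler` says what recursive calls return and how many steps
they take. The result is the returned value and the number of executed instructions, where the
instructions executed within recursive calls are included. Division by zero is an error (`none`), and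
so is a recursive call that is not answered. -/
def Prog.run {α : Type v} (handler : (n : ℕ) → Problem F n → Option (Result F n × ℕ)) :
    Prog F α → Option (α × ℕ)
  | ret a => some (a, 0)
  | constZero k => tick ((k 0).run handler)
  | constOne k => tick ((k 1).run handler)
  | arith .add x y k => tick ((k (x + y)).run handler)
  | arith .sub x y k => tick ((k (x - y)).run handler)
  | arith .mul x y k => tick ((k (x * y)).run handler)
  | arith .div x y k => if y = 0 then none else tick ((k (x / y)).run handler)
  | ifLE x y yes no => tick (if x ≤ y then yes.run handler else no.run handler)
  | @call _ _ n P k =>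
    match handler n P with
    | none => none
    | some (r, s) => ((k r).run handler).map fun q => (q.1, s + q.2 + 1)

/-- Run a program that makes no recursive calls. -/
def Prog.runLocal {α : Type v} (p : Prog F α) : Option (α × ℕ) := p.run fun _ _ => none

/-- Run the recursive procedure with at most `depth` nested activations; `none` if the execution needs
more of them (or fails by division by zero). -/
def exec (R : Subroutines F) : (depth : ℕ) → (n : ℕ) → Problem F n → Option (Result F n × ℕ)
  | 0, _, _ => none
  | depth + 1, _, P => (minQP R P).run (exec R depth)

/-- The procedure terminates on `P` after exactly `steps` steps and returns `r`. -/
def Halts (R : Subroutines F) {n : ℕ} (P : Problem F n) (steps : ℕ) (r : Result F n) : Prop :=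
  ∃ depth₀, ∀ depth ≥ depth₀, exec R depth n P = some (r, steps)

end Execution

/-! ## What the data mean, and what the subroutines have to do -/

section Spec

open Matrix

variable {F : Type u} [Field F] [LinearOrder F]

/-- The quadratic function `x ↦ xᵀ Q x + cᵀ x + γ`. -/
def Objective.value {n : ℕ} (f : Objective F n) (x : Fin n → F) : F :=
  x ⬝ᵥ (f.Q *ᵥ x) + f.c ⬝ᵥ x + f.γ

/-- The polyhedron of an instance. -/
def Problem.polyhedron {n : ℕ} (P : Problem F n) : Set (Fin n → F) :=
  {x | ∀ r ∈ P.cons, r.a ⬝ᵥ x ≤ r.b}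

/-- `D` is a decoupled diagonal form of `f`. -/
structure Decomposition.IsDecoupledFormOf {n : ℕ} (D : Decomposition F n) (f : Objective F n) :
    Prop where
  mul_inv : D.S * D.Sinv = 1
  decoupled : diagonal D.Λ *ᵥ D.u = 0
  value_eq : ∀ x, f.value x =
    (x - D.v) ⬝ᵥ ((D.Sᵀ * diagonal D.Λ * D.S) *ᵥ (x - D.v)) + D.u ⬝ᵥ (D.S *ᵥ (x - D.v)) + D.γ

/-- `r` is the correct answer for `P`. -/
def Result.IsCorrectFor {n : ℕ} (P : Problem F n) : Result F n → Prop
  | .infeasible => P.polyhedron = ∅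
  | .unbounded => ∀ ε, ∃ x ∈ P.polyhedron, P.obj.value x < ε
  | .optimal val x => x ∈ P.polyhedron ∧ val = P.obj.value x ∧
      ∀ y ∈ P.polyhedron, P.obj.value x ≤ P.obj.value y

/-- The specification of the subroutines: each of them halts without error and without recursive
calls and delivers what it has to deliver. -/
structure Subroutines.MeetsSpec (R : Subroutines F) : Prop where
  diagonalize : ∀ {n : ℕ} (f : Objective F n), f.Q.IsSymm →
    ∃ D t, (R.diagonalize f).runLocal = some (D, t) ∧ D.IsDecoupledFormOf f
  parameterize : ∀ {n : ℕ} (r : Constraint F n), r.a ≠ 0 →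
    ∃ σ t, (R.parameterize r).runLocal = some (σ, t) ∧
      Set.range (fun z => σ.M *ᵥ z + σ.p) = {y | r.a ⬝ᵥ y = r.b}
  solveUnivariate : ∀ P : Problem F 1, (∀ r ∈ P.cons, r.a ≠ 0) →
    ∃ s t, (R.solveUnivariate P).runLocal = some (s, t) ∧ s.IsCorrectFor P

end Spec

end QP

open scoped Matrix

/-! In diagonal coordinates the objective is a sum of one-variable functions `Λ i * y i ^ 2 + u i *
y i` plus a constant, with `Λ i * u i = 0`. Either every `Λ i` is nonnegative and `u = 0`, so that
the origin minimizes the objective globally, or some coordinate has `Λ i < 0` or `u i ≠ 0`, and then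
from every point the objective falls without bound along one direction of that coordinate, never
exceeding its starting value.

The heart of the matter is `exists_tight_le_or_unbounded`: within one orthant, unless the origin is
a feasible global minimum, every feasible point is matched by a tight one of no larger value, or the
objective is unbounded below on the tight points. If a descent ray leaves the polyhedron, its first
hit is tight. If it stays inside, a second coordinate (hence `2 ≤ n`) is moved towards `0` until
some row is tight; the orthant rows guarantee a hit, and the cost depends only on that second
coordinate, which is constant along the ray. If the origin is a global minimum but infeasible, the
segment towards it lowers the objective and meets a tight point before the origin.

So it suffices to minimize over the facets, which are instances of dimension `n - 1`. No
completeness of the field is needed: first hits come from a ratio test on finitely many rows, and a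
minimum exists because the recursive calls leave finitely many candidates. If no call reports
unboundedness, the least candidate is optimal, and the absence of candidates means infeasibility
(`facetLoop`, `orthantLoop`, `solveMultivariate`).

Programs are handled by a Hoare-style calculus around `Yields`, which asks for the same result and
step count under a whole set of handlers. Taking all sufficiently deep executions as that set makes
the induction on the dimension in `exists_exec_eq` give an answer independent of the recursion
depth. The standard subroutines are verified in the same calculus. -/

namespace QP

open Prog

/-! ## A calculus for programs -/

section Calculus

variable {F : Type u} [Field F] [LinearOrder F]

/-- Answers to recursive calls, with step counts. -/
abbrev Handler (F : Type u) := (n : ℕ) → Problem F n → Option (Result F n × ℕ)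

/-- Under all handlers in `H`, the program halts without error with the same result and the same
number of steps, and the result satisfies `post`. -/
def Prog.Yields {α : Type v} (H : Set (Handler F)) (p : Prog F α) (post : α → Prop) : Prop :=
  ∃ a s, (∀ h ∈ H, p.run h = some (a, s)) ∧ post a

theorem tick_map {α β : Type v} (o : Option (α × ℕ)) (g : α × ℕ → Option (β × ℕ)) :
    (tick o).bind (fun q => (g q).map fun r => (r.1, q.2 + r.2)) =
      tick (o.bind fun q => (g (q.1, q.2 + 1)).map fun r => (r.1, q.2 + r.2)) := by
  cases o with
  | none => rfl
  | some q =>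
    simp only [tick, Option.map_some, Option.bind_some]
    cases g (q.1, q.2 + 1) with
    | none => rfl
    | some r => simp; omega

/-- Costs are additive under sequencing, and an error in either part is an error of the whole. By
`tick_map`, a step counted inside the first part can be moved outside. -/
theorem Prog.run_bind {α β : Type v} (h : Handler F) (p : Prog F α) (g : α → Prog F β) :
    (p.bind g).run h =
      (p.run h).bind fun q => ((g q.1).run h).map fun r => (r.1, q.2 + r.2) := by
  induction p with
  | ret a => simp [Prog.bind, Prog.run]
  | constZero k ih =>
    rw [Prog.bind, Prog.run, Prog.run, tick_map _ (fun q => (g q.1).run h), ih]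
  | constOne k ih =>
    rw [Prog.bind, Prog.run, Prog.run, tick_map _ (fun q => (g q.1).run h), ih]
  | arith o x y k ih =>
    cases o
    · rw [Prog.bind, Prog.run, Prog.run, tick_map _ (fun q => (g q.1).run h), ih]
    · rw [Prog.bind, Prog.run, Prog.run, tick_map _ (fun q => (g q.1).run h), ih]
    · rw [Prog.bind, Prog.run, Prog.run, tick_map _ (fun q => (g q.1).run h), ih]
    · rw [Prog.bind, Prog.run, Prog.run]
      split_ifs
      · rfl
      · rw [tick_map _ (fun q => (g q.1).run h), ih]
  | ifLE x y yes no ih₁ ih₂ =>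
    rw [Prog.bind, Prog.run, Prog.run]
    split_ifs
    · rw [tick_map _ (fun q => (g q.1).run h), ih₁]
    · rw [tick_map _ (fun q => (g q.1).run h), ih₂]
  | @call n P k ih =>
    rw [Prog.bind, Prog.run, Prog.run]
    cases h n P with
    | none => rfl
    | some q =>
      simp only [ih]
      cases (k q.1).run h with
      | none => rfl
      | some r =>
        simp only [Option.bind_some, Option.map_some]
        cases (g r.1).run h with
        | none => rfl
        | some t => simp; omega

/-- A program that halts without recursive calls does not depend on the handler. -/
theorem Prog.run_of_runLocal {α : Type v} (h : Handler F) (p : Prog F α) {q : α × ℕ}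
    (hp : p.runLocal = some q) : p.run h = some q := by
  have tick_some {o o' : Option (α × ℕ)} (H : ∀ q, o = some q → o' = some q) {q}
      (hq : tick o = some q) : tick o' = some q := by
    cases o with
    | none => simp [tick] at hq
    | some r => rw [H r rfl, hq]
  unfold Prog.runLocal at hp
  induction p generalizing q with
  | ret a => exact hp
  | constZero k ih => exact tick_some (fun q => ih 0) hp
  | constOne k ih => exact tick_some (fun q => ih 1) hp
  | arith o x y k ih =>
    cases o
    · exact tick_some (fun q => ih _) hp
    · exact tick_some (fun q => ih _) hp
    · exact tick_some (fun q => ih _) hp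
    · rw [Prog.run] at hp ⊢
      split_ifs at hp ⊢
      exact tick_some (fun q => ih _) hp
  | ifLE x y yes no ih₁ ih₂ =>
    rw [Prog.run] at hp ⊢
    split_ifs at hp ⊢
    · exact tick_some (fun q => ih₁) hp
    · exact tick_some (fun q => ih₂) hp
  | call P k ih => simp [Prog.run] at hp

/-- The row obtained by substituting `x = M z + p`. -/
def Constraint.pullback {n k : ℕ} (σ : Substitution F n k) (r : Constraint F n) :
    Constraint F k :=
  ⟨r.a ᵥ* σ.M, r.b - r.a ⬝ᵥ σ.p⟩

theorem Constraint.pullback_le_iff [IsStrictOrderedRing F] {n k : ℕ}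
    (σ : Substitution F n k) (r : Constraint F n) (z : Fin k → F) :
    (r.pullback σ).a ⬝ᵥ z ≤ (r.pullback σ).b ↔ r.a ⬝ᵥ (σ.M *ᵥ z + σ.p) ≤ r.b := by
  simp only [Constraint.pullback]
  rw [dotProduct_add, Matrix.dotProduct_mulVec, le_sub_iff_add_le]

/-! ### Proof rules for `Yields`, one for each elementary program. -/

namespace Prog.Yields

variable {H : Set (Handler F)}

theorem of_runLocal {α : Type v} {p : Prog F α} {a : α} {s : ℕ} {post : α → Prop}
    (hp : p.runLocal = some (a, s)) (ha : post a) : p.Yields H post :=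
  ⟨a, s, fun h _ => p.run_of_runLocal h hp, ha⟩

theorem ret {α : Type v} {a : α} {post : α → Prop} (ha : post a) : (ret a).Yields H post :=
  ⟨a, 0, fun _ _ => rfl, ha⟩

theorem mono {α : Type v} {p : Prog F α} {post post' : α → Prop} (hp : p.Yields H post)
    (h : ∀ a, post a → post' a) : p.Yields H post' :=
  let ⟨a, s, hr, ha⟩ := hp
  ⟨a, s, hr, h a ha⟩

theorem bind {α β : Type u} {p : Prog F α} {g : α → Prog F β} {post : α → Prop}
    {post' : β → Prop} (hp : p.Yields H post) (hg : ∀ a, post a → (g a).Yields H post') :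
    (p >>= g).Yields H post' := by
  obtain ⟨a, s, hr, ha⟩ := hp
  obtain ⟨b, t, hr', hb⟩ := hg a ha
  refine ⟨b, s + t, fun h hh => ?_, hb⟩
  change (p.bind g).run h = _
  rw [run_bind, hr h hh]
  simp [hr' h hh]

theorem zero : (Prog.zero : Prog F F).Yields H (· = 0) := ⟨0, 1, fun _ _ => rfl, rfl⟩

theorem one : (Prog.one : Prog F F).Yields H (· = 1) := ⟨1, 1, fun _ _ => rfl, rfl⟩

theorem add (x y : F) : (Prog.add x y).Yields H (· = x + y) := ⟨_, 1, fun _ _ => rfl, rfl⟩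

theorem sub (x y : F) : (Prog.sub x y).Yields H (· = x - y) := ⟨_, 1, fun _ _ => rfl, rfl⟩

theorem mul (x y : F) : (Prog.mul x y).Yields H (· = x * y) := ⟨_, 1, fun _ _ => rfl, rfl⟩

theorem div (x : F) {y : F} (hy : y ≠ 0) : (Prog.div x y).Yields H (· = x / y) :=
  ⟨x / y, 1, fun h _ => by simp [Prog.div, Prog.run, hy, tick], rfl⟩

theorem neg (x : F) : (Prog.neg x).Yields H (· = -x) := by
  refine zero.bind ?_
  rintro _ rfl
  simpa using sub (H := H) 0 x

theorem leTest (x y : F) : (Prog.leTest x y).Yields H (fun b => b.down = true ↔ x ≤ y) :=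
  ⟨⟨decide (x ≤ y)⟩, 1, fun h _ => by
    by_cases hxy : x ≤ y <;> simp [Prog.leTest, Prog.run, hxy, tick], by simp⟩

theorem zeroTest (x : F) : (Prog.zeroTest x).Yields H (fun b => b.down = true ↔ x = 0) := by
  refine zero.bind ?_
  rintro _ rfl
  -- A positive `x` fails the first comparison, so the second one is not executed; this is why the
  -- step counts differ.
  rcases lt_trichotomy x 0 with h | h | h
  · exact ⟨⟨false⟩, 2, fun _ _ => by simp [Prog.run, h.le, h.not_ge, tick], by simp [h.ne]⟩
  · exact ⟨⟨true⟩, 2, fun _ _ => by simp [Prog.run, h, tick], by simp [h]⟩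
  · exact ⟨⟨false⟩, 1, fun _ _ => by simp [Prog.run, h.not_ge, tick], by simp [h.ne']⟩

theorem allTest {β : Type} {test : β → Prog F (ULift.{u} Bool)} {q : β → Prop} {l : List β}
    (h : ∀ x ∈ l, (test x).Yields H (fun b => b.down = true ↔ q x)) :
    (Prog.allTest test l).Yields H (fun b => b.down = true ↔ ∀ x ∈ l, q x) := by
  induction l with
  | nil => exact .ret (by simp)
  | cons a l ih =>
    refine (h a (by simp)).bind fun b hb => ?_
    split_ifs with hc
    · refine (ih fun x hx => h x (by simp [hx])).mono fun b' hb' => ?_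
      simp [hb', hb.1 hc]
    · refine .ret ?_
      simp [← hb, hc]

theorem vec {β : Type u} {n : ℕ} {f : Fin n → Prog F β} {post : Fin n → β → Prop}
    (h : ∀ i, (f i).Yields H (post i)) : (Prog.vec f).Yields H (fun w => ∀ i, post i (w i)) := by
  induction n with
  | zero => exact .ret fun i => i.elim0
  | succ n ih =>
    refine (h 0).bind fun x hx => (ih fun i => h i.succ).bind fun xs hxs => .ret fun i => ?_
    refine Fin.cases ?_ (fun i => ?_) i
    · simpa using hx
    · simpa using hxs i

theorem vec_eq {β : Type u} {n : ℕ} {f : Fin n → Prog F β} {w : Fin n → β}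
    (h : ∀ i, (f i).Yields H (· = w i)) : (Prog.vec f).Yields H (· = w) :=
  (vec h).mono fun _ => funext

theorem mat {m n : ℕ} {f : Fin m → Fin n → Prog F F} {M : Matrix (Fin m) (Fin n) F}
    (h : ∀ i j, (f i j).Yields H (· = M i j)) : (Prog.mat f).Yields H (· = M) := by
  refine (vec_eq (w := M) fun i => vec_eq (h i)).bind ?_
  rintro _ rfl
  exact .ret rfl

theorem mapList {α β : Type u} {f : α → Prog F β} {l : List α} {post : α → β → Prop}
    (h : ∀ a ∈ l, (f a).Yields H (post a)) :
    (Prog.mapList f l).Yields H (List.Forall₂ post l) := by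
  induction l with
  | nil => exact .ret .nil
  | cons a l ih =>
    exact (h a (by simp)).bind fun x hx => (ih fun x hx => h x (by simp [hx])).bind
      fun xs hxs => .ret (.cons hx hxs)

theorem mapList_eq {α β : Type u} {f : α → Prog F β} {l : List α} {g : α → β}
    (h : ∀ a ∈ l, (f a).Yields H (· = g a)) : (Prog.mapList f l).Yields H (· = l.map g) := by
  induction l with
  | nil => exact .ret rfl
  | cons a l ih =>
    refine (h a (by simp)).bind fun x hx => (ih fun x hx => h x (by simp [hx])).bind
      fun xs hxs => .ret ?_
    rw [hx, hxs, List.map_cons]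

theorem sum {n : ℕ} {f : Fin n → Prog F F} {w : Fin n → F}
    (h : ∀ i, (f i).Yields H (· = w i)) : (Prog.sum f).Yields H (· = ∑ i, w i) := by
  induction n with
  | zero => exact zero.mono fun a ha => by simpa using ha
  | succ n ih =>
    refine (h 0).bind fun x hx => (ih fun i => h i.succ).bind fun s hs => ?_
    refine (add _ _).mono fun a ha => ?_
    rw [ha, hx, hs, Fin.sum_univ_succ]

theorem dot {n : ℕ} (x y : Fin n → F) : (Prog.dot x y).Yields H (· = x ⬝ᵥ y) :=
  sum fun i => mul (x i) (y i)

theorem apply {n k : ℕ} (σ : Substitution F n k) (z : Fin k → F) :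
    (σ.apply z).Yields H (· = σ.M *ᵥ z + σ.p) := by
  refine vec_eq fun i => (dot _ _).bind ?_
  rintro _ rfl
  exact add _ _

theorem constraint_subst {n k : ℕ} (σ : Substitution F n k) (r : Constraint F n) :
    (r.subst σ).Yields H (· = r.pullback σ) := by
  refine (vec_eq fun j => dot r.a fun i => σ.M i j).bind ?_
  rintro _ rfl
  refine (dot _ _).bind ?_
  rintro _ rfl
  refine (sub _ _).bind ?_
  rintro _ rfl
  exact .ret rfl

/-- Correctness of an answer involves the objective only through its values, so nothing is recorded
about the new matrix; each activation symmetrizes anew. -/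
theorem objective_subst {n k : ℕ} (σ : Substitution F n k) (f : Objective F n) :
    (f.subst σ).Yields H (fun g => ∀ z, g.value z = f.value (σ.M *ᵥ z + σ.p)) := by
  refine (mat (M := f.Q * σ.M) fun i j => dot _ _).bind ?_
  rintro _ rfl
  refine (mat (M := σ.Mᵀ * (f.Q * σ.M)) fun i j => dot _ _).bind ?_
  rintro _ rfl
  refine (vec_eq (w := f.Q *ᵥ σ.p) fun i => dot _ _).bind ?_
  rintro _ rfl
  refine (vec_eq (w := f.Qᵀ *ᵥ σ.p) fun i => dot _ _).bind ?_
  rintro _ rfl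
  refine (vec_eq (w := f.Q *ᵥ σ.p + f.Qᵀ *ᵥ σ.p + f.c) fun i => (add _ _).bind ?_).bind ?_
  · rintro _ rfl
    exact add _ _
  rintro _ rfl
  refine (vec_eq (w := σ.Mᵀ *ᵥ (f.Q *ᵥ σ.p + f.Qᵀ *ᵥ σ.p + f.c)) fun i => dot _ _).bind ?_
  rintro _ rfl
  refine (dot _ _).bind ?_
  rintro _ rfl
  refine (dot _ _).bind ?_
  rintro _ rfl
  refine (add _ _).bind ?_
  rintro _ rfl
  refine (add _ _).bind ?_
  rintro _ rfl
  refine .ret fun z => ?_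
  have h₁ : ∀ (w : Fin n → F), (σ.Mᵀ *ᵥ w) ⬝ᵥ z = (σ.M *ᵥ z) ⬝ᵥ w := fun w => by
    rw [Matrix.mulVec_transpose, ← Matrix.dotProduct_mulVec, dotProduct_comm]
  have h₂ : z ⬝ᵥ ((σ.Mᵀ * (f.Q * σ.M)) *ᵥ z) = (σ.M *ᵥ z) ⬝ᵥ (f.Q *ᵥ (σ.M *ᵥ z)) := by
    rw [← Matrix.mulVec_mulVec, dotProduct_comm, h₁, Matrix.mulVec_mulVec]
  have h₃ : (σ.M *ᵥ z) ⬝ᵥ (f.Qᵀ *ᵥ σ.p) = σ.p ⬝ᵥ (f.Q *ᵥ (σ.M *ᵥ z)) := by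
    rw [Matrix.mulVec_transpose, dotProduct_comm, ← Matrix.dotProduct_mulVec]
  simp only [Objective.value, h₁, h₂, Matrix.mulVec_add, dotProduct_add, add_dotProduct, h₃]
  rw [dotProduct_comm f.c (σ.M *ᵥ z)]
  ring

end Prog.Yields

end Calculus

/-! ## Lagrange diagonalization -/

section Lagrange

variable {F : Type u} [Field F] {n : ℕ}

/-- The effect of `DiagState.addCol` in terms of elementary matrices. -/
def DiagState.elementary (s : DiagState F n) (i j : Fin n) (α : F) : DiagState F n :=
  ⟨s.T * Matrix.transvection j i α, Matrix.transvection j i (-α) * s.S,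
    Matrix.transvection i j α * (s.D * Matrix.transvection j i α)⟩

theorem DiagState.elementary_D_of_ne (s : DiagState F n) {i j : Fin n} (α : F) {a b : Fin n}
    (ha : a ≠ i) (hb : b ≠ i) : (s.elementary i j α).D a b = s.D a b := by
  simp [elementary, ha, hb]

theorem DiagState.elementary_D_col (s : DiagState F n) {i j : Fin n} (α : F) {a : Fin n}
    (ha : a ≠ i) : (s.elementary i j α).D a i = s.D a i + α * s.D a j := by
  simp [elementary, ha]

theorem DiagState.elementary_D_diag (s : DiagState F n) {i j : Fin n} (α : F) :
    (s.elementary i j α).D i i =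
      s.D i i + α * s.D i j + α * (s.D j i + α * s.D j j) := by
  simp [elementary]

/-- The state is a partial diagonalization of `Q`, in which the rows in `done` are finished. -/
structure DiagState.Diagonalizes (s : DiagState F n) (Q : Matrix (Fin n) (Fin n) F)
    (done : List (Fin n)) : Prop where
  mul_inv : s.S * s.T = 1
  congr : s.D = s.Tᵀ * Q * s.T
  offDiag : ∀ i ∈ done, ∀ j, j ≠ i → s.D i j = 0

variable {Q : Matrix (Fin n) (Fin n) F} {done : List (Fin n)} {s : DiagState F n}

theorem DiagState.Diagonalizes.isSymm (hs : s.Diagonalizes Q done) (hQ : Q.IsSymm) :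
    s.D.IsSymm := by
  rw [Matrix.IsSymm, hs.congr]
  simp [Matrix.transpose_mul, hQ.eq, Matrix.mul_assoc]

theorem DiagState.Diagonalizes.elementary (hs : s.Diagonalizes Q done) {i j : Fin n}
    (hij : i ≠ j) (hi : i ∉ done) (hj : j ∉ done) (α : F) :
    (s.elementary i j α).Diagonalizes Q done where
  mul_inv := by
    simp only [DiagState.elementary]
    rw [Matrix.mul_assoc, ← Matrix.mul_assoc s.S, hs.mul_inv, Matrix.one_mul,
      Matrix.transvection_mul_transvection_same _ _ hij.symm]
    simp
  congr := by
    simp only [DiagState.elementary]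
    rw [hs.congr, Matrix.transpose_mul]
    simp only [Matrix.mul_assoc]
    congr 1
    simp [Matrix.transvection]
  offDiag a ha b hb := by
    have hai : a ≠ i := fun h => hi (h ▸ ha)
    have haj : a ≠ j := fun h => hj (h ▸ ha)
    -- A finished row `a` has zeros in both columns `i` and `j`, so adding a multiple of one to the
    -- other keeps it finished.
    by_cases hbi : b = i
    · subst hbi
      rw [DiagState.elementary_D_col _ _ hai, hs.offDiag a ha b hb, hs.offDiag a ha j haj.symm]
      simp
    · rw [DiagState.elementary_D_of_ne _ _ hai hbi, hs.offDiag a ha b hb]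

variable [LinearOrder F] {H : Set (Handler F)}

theorem Prog.Yields.addCol (s : DiagState F n) (i j : Fin n) (α : F) :
    (s.addCol i j α).Yields H (· = s.elementary i j α) := by
  have key (M : Matrix (Fin n) (Fin n) F) : (Prog.mat fun a b => do
      if b = i then Prog.add (M a b) (← Prog.mul α (M a j)) else Prog.ret (M a b)).Yields H
      (· = M * Matrix.transvection j i α) := by
    refine mat fun a b => ?_
    split_ifs with hb
    · subst hb
      refine (mul _ _).bind ?_
      rintro _ rfl
      simpa using add _ _
    · exact .ret (by simp [hb])
  refine (key s.T).bind ?_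
  rintro _ rfl
  refine (mat (M := Matrix.transvection j i (-α) * s.S) fun a b => ?_).bind ?_
  · split_ifs with ha
    · subst ha
      refine (mul _ _).bind ?_
      rintro _ rfl
      simpa [← sub_eq_add_neg] using sub _ _
    · exact .ret (by simp [ha])
  rintro _ rfl
  refine (key s.D).bind ?_
  rintro _ rfl
  refine (mat (M := Matrix.transvection i j α * (s.D * Matrix.transvection j i α))
    fun a b => ?_).bind ?_
  · split_ifs with ha
    · subst ha
      refine (mul _ _).bind ?_
      rintro _ rfl
      simpa using add _ _
    · exact .ret (by simp [ha])
  rintro _ rfl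
  exact .ret rfl

theorem Prog.Yields.firstNonzero (w : Fin n → F) (l : List (Fin n)) :
    (QP.firstNonzero w l).Yields H fun o =>
      (o = none ∧ ∀ i ∈ l, w i = 0) ∨ ∃ j, o = some ⟨j⟩ ∧ j ∈ l ∧ w j ≠ 0 := by
  induction l with
  | nil => exact .ret (by simp)
  | cons i l ih =>
    refine (zeroTest _).bind fun b hb => ?_
    split_ifs with h
    · refine ih.mono ?_
      rintro o (⟨ho, hl⟩ | ⟨j, ho, hj, hw⟩)
      · exact .inl ⟨ho, by simpa [hb.1 h] using hl⟩
      · exact .inr ⟨j, ho, by simp [hj], hw⟩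
    · exact .ret (.inr ⟨i, rfl, by simp, fun hw => h (hb.2 hw)⟩)

variable [IsStrictOrderedRing F]

/-- If `D k k = 0` and `D k j ≠ 0`, adding `α` times column and row `j` makes the pivot `2 * α * D k
j + α ^ 2 * D j j`. For `α = 1` and `α = -1` these values differ by `4 * D k j ≠ 0`, so one of the
two attempts succeeds. -/
theorem Prog.Yields.fixPivot (hQ : Q.IsSymm) (hs : s.Diagonalizes Q done) {k : Fin n}
    (hdone : ∀ i ∈ done, i < k) :
    (s.fixPivot k).Yields H fun s' => s'.Diagonalizes Q done ∧
      (s'.D k k = 0 → ∀ j, k < j → s'.D k j = 0) := by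
  have hk : k ∉ done := fun h => lt_irrefl _ (hdone k h)
  refine (zeroTest _).bind fun b hb => ?_
  split_ifs with h
  · have h0 := hb.1 h
    refine (firstNonzero _ _).bind ?_
    rintro _ (⟨rfl, hl⟩ | ⟨j, rfl, hj, hw⟩)
    · exact .ret ⟨hs, fun _ j hj => hl j (by simpa using hj)⟩
    · have hkj : k < j := by simpa using hj
      have hj' : j ∉ done := fun h => lt_asymm hkj (hdone j h)
      have hsymm : s.D j k = s.D k j := (hs.isSymm hQ).apply k j
      refine one.bind ?_
      rintro _ rfl
      refine (addCol _ _ _ _).bind ?_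
      rintro _ rfl
      refine (zeroTest _).bind fun b' hb' => ?_
      split_ifs with h'
      · refine (neg _).bind ?_
        rintro _ rfl
        refine (addCol _ _ _ _).mono ?_
        rintro _ rfl
        refine ⟨hs.elementary hkj.ne hk hj' _, fun h₂ => absurd ?_ hw⟩
        have h₁ := hb'.1 h'
        rw [DiagState.elementary_D_diag] at h₁ h₂
        rw [hsymm] at h₁ h₂
        linarith
      · exact .ret ⟨hs.elementary hkj.ne hk hj' _, fun h₂ => absurd (hb'.2 h₂) h'⟩
  · exact .ret ⟨hs, fun h0 => absurd (hb.2 h0) h⟩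

-- Clearing the entry in column `j` changes no other entry of row `k`, in particular not the pivot.
-- The last clause of the postcondition keeps entries cleared earlier at zero while the rest of the
-- list is processed.
omit [IsStrictOrderedRing F] in
theorem Prog.Yields.clearRow {k : Fin n} (hk : k ∉ done) (l : List (Fin n))
    (hl : ∀ j ∈ l, k ≠ j ∧ j ∉ done) (hs : s.Diagonalizes Q done) (hkk : s.D k k ≠ 0) :
    (DiagState.clearRow k s l).Yields H fun s' => s'.Diagonalizes Q done ∧
      (∀ j ∈ l, s'.D k j = 0) ∧ ∀ j ∉ l, s'.D k j = s.D k j := by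
  induction l generalizing s with
  | nil => exact .ret ⟨hs, by simp, by simp⟩
  | cons j l ih =>
    obtain ⟨hkj, hj⟩ := hl j (by simp)
    refine (div _ hkk).bind ?_
    rintro _ rfl
    refine (neg _).bind ?_
    rintro _ rfl
    refine (addCol _ _ _ _).bind ?_
    rintro _ rfl
    have hD (b : Fin n) (hb : b ≠ j) := s.elementary_D_of_ne (j := k) (-(s.D k j / s.D k k)) hkj hb
    have hDj := s.elementary_D_col (j := k) (-(s.D k j / s.D k k)) hkj
    refine (ih (fun i hi => hl i (by simp [hi])) (hs.elementary hkj.symm hj hk _)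
      (by rwa [hD k hkj])).mono ?_
    rintro s' ⟨h₁, h₂, h₃⟩
    refine ⟨h₁, fun i hi => ?_, fun i hi => ?_⟩
    · by_cases hil : i ∈ l
      · exact h₂ i hil
      · obtain rfl : i = j := by simpa [hil] using hi
        rw [h₃ i hil, hDj]
        field_simp
        ring
    · rw [h₃ i (fun h => hi (by simp [h])), hD i (fun h => hi (by simp [h]))]

theorem Prog.Yields.lagrange (hQ : Q.IsSymm) (l : List (Fin n))
    (hl : done ++ l = List.finRange n) (hs : s.Diagonalizes Q done) :
    (DiagState.lagrange s l).Yields H fun s' => s'.Diagonalizes Q (List.finRange n) := by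
  induction l generalizing s done with
  | nil =>
    rw [List.append_nil] at hl
    subst hl
    exact .ret hs
  | cons k l ih =>
    have hsorted := hl ▸ List.pairwise_lt_finRange n
    rw [List.pairwise_append] at hsorted
    have hdone : ∀ i ∈ done, i < k := fun i hi => hsorted.2.2 i hi k (by simp)
    have hk : k ∉ done := fun h => lt_irrefl _ (hdone k h)
    have hlt : ∀ j, j ∉ done → j ≠ k → k < j := fun j hj hjk => by
      have : j ∈ done ++ k :: l := hl ▸ List.mem_finRange j
      have : j ∈ l := by simpa [hj, hjk] using this
      exact (List.pairwise_cons.1 hsorted.2.1).1 j this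
    -- Zeros to the right of the diagonal are enough: the entries to the left lie in finished
    -- columns and vanish by symmetry.
    have extend {t : DiagState F n} (ht : t.Diagonalizes Q done)
        (hrow : ∀ j, k < j → t.D k j = 0) : t.Diagonalizes Q (done ++ [k]) := by
      refine ⟨ht.mul_inv, ht.congr, fun i hi j hj => ?_⟩
      rcases List.mem_append.1 hi with hi | hi
      · exact ht.offDiag i hi j hj
      · obtain rfl : i = k := by simpa using hi
        by_cases hjd : j ∈ done
        · rw [← (ht.isSymm hQ).apply]
          exact ht.offDiag j hjd i hj.symm
        · exact hrow j (hlt j hjd hj)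
    refine (fixPivot hQ hs hdone).bind ?_
    rintro s' ⟨hs', hpivot⟩
    refine (zeroTest _).bind fun b hb => ?_
    split_ifs with h
    · exact ih (by simpa using hl) (extend hs' (hpivot (hb.1 h)))
    · refine (clearRow hk _ (fun j hj => ?_) hs' (fun h0 => h (hb.2 h0))).bind ?_
      · have hkj : k < j := by simpa using hj
        exact ⟨hkj.ne, fun hjd => lt_asymm hkj (hdone j hjd)⟩
      rintro t ⟨ht, hrow, -⟩
      exact ih (by simpa using hl) (extend ht fun j hj => hrow j (by simpa using hj))

/-! ### Completion of squares and the decoupled form. -/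

omit [LinearOrder F] [IsStrictOrderedRing F] in
theorem decoupled_value_eq_sum (S : Matrix (Fin n) (Fin n) F) (Λ u w : Fin n → F) :
    w ⬝ᵥ ((Sᵀ * Matrix.diagonal Λ * S) *ᵥ w) + u ⬝ᵥ (S *ᵥ w) =
      ∑ i, (Λ i * (S *ᵥ w) i ^ 2 + u i * (S *ᵥ w) i) := by
  rw [← Matrix.mulVec_mulVec, ← Matrix.mulVec_mulVec, Matrix.dotProduct_mulVec w,
    Matrix.vecMul_transpose, Finset.sum_add_distrib]
  congr 1
  exact Finset.sum_congr rfl fun i _ => by rw [Matrix.mulVec_diagonal]; ring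

/-- Either `lam = 0` and the linear term is kept, or the linear term is absorbed by the center `-c /
(2 * lam)`; so `lam` times the remaining linear coefficient is always `0`. The divisors are non-zero
because an ordered field has characteristic zero. -/
theorem Prog.Yields.completeSquare (lam c : F) :
    (QP.completeSquare lam c).Yields H fun w => lam * w.2.1 = 0 ∧
      ∀ y, lam * (y - w.1) ^ 2 + w.2.1 * (y - w.1) = lam * y ^ 2 + c * y + w.2.2 := by
  refine zero.bind ?_
  rintro _ rfl
  refine (zeroTest _).bind fun b hb => ?_
  split_ifs with h
  · exact .ret (by simp [hb.1 h])
  · have hlam : lam ≠ 0 := fun h0 => h (hb.2 h0)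
    have h2 : lam + lam ≠ 0 := by
      rw [← two_mul]
      exact mul_ne_zero two_ne_zero hlam
    have h4 : lam + lam + (lam + lam) ≠ 0 := by
      rw [← two_mul]
      exact mul_ne_zero two_ne_zero h2
    refine (add _ _).bind ?_
    rintro _ rfl
    refine (div _ h2).bind ?_
    rintro _ rfl
    refine (neg _).bind ?_
    rintro _ rfl
    refine (mul _ _).bind ?_
    rintro _ rfl
    refine (add _ _).bind ?_
    rintro _ rfl
    refine (div _ h4).bind ?_
    rintro _ rfl
    refine .ret ⟨by simp, fun y => ?_⟩
    simp only [← two_mul]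
    field_simp
    ring

theorem Prog.Yields.decoupledForm {f : Objective F n} (hf : f.Q.IsSymm) :
    (QP.decoupledForm f).Yields H fun D => D.IsDecoupledFormOf f := by
  refine zero.bind ?_
  rintro _ rfl
  refine one.bind ?_
  rintro _ rfl
  have h1 : (Matrix.of fun i j => if i = j then (1 : F) else 0) =
      (1 : Matrix (Fin n) (Fin n) F) := by
    ext i j
    simp [Matrix.one_apply]
  refine (lagrange (done := []) hf _ rfl ⟨?_, ?_, by simp⟩).bind fun s hs => ?_
  · simp [h1]
  · simp [h1]
  refine (vec_eq (w := s.Tᵀ *ᵥ f.c) fun i => dot _ _).bind ?_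
  rintro _ rfl
  refine (vec fun i => completeSquare _ _).bind fun w hw => ?_
  refine (vec_eq (w := s.T *ᵥ fun j => (w j).1) fun i => dot _ _).bind ?_
  rintro _ rfl
  refine (sum (w := fun i => (w i).2.2) fun i => .ret rfl).bind ?_
  rintro _ rfl
  refine (sub _ _).bind ?_
  rintro _ rfl
  have hTS : s.T * s.S = 1 := mul_eq_one_comm.1 hs.mul_inv
  refine .ret ⟨hs.mul_inv, ?_, fun x => ?_⟩
  · ext i
    simp [Matrix.mulVec_diagonal, (hw i).1]
  · have hD : s.D = Matrix.diagonal fun i => s.D i i := by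
      ext i j
      by_cases hij : j = i
      · simp [hij]
      · rw [hs.offDiag i (List.mem_finRange i) j hij, Matrix.diagonal_apply_ne' _ hij]
    -- In the coordinates `y` the shift becomes `y - w`, with `w` the vector of centers, and the
    -- identity splits into one completed square per coordinate.
    obtain ⟨y, rfl⟩ : ∃ y, x = s.T *ᵥ y := ⟨s.S *ᵥ x, by simp [hTS]⟩
    have hx : f.value (s.T *ᵥ y) =
        ∑ i, (s.D i i * y i ^ 2 + (s.Tᵀ *ᵥ f.c) i * y i) + f.γ := by
      have := decoupled_value_eq_sum 1 (fun i => s.D i i) (s.Tᵀ *ᵥ f.c) y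
      simp only [Matrix.transpose_one, Matrix.one_mul, Matrix.mul_one, Matrix.one_mulVec] at this
      rw [← this, ← hD, hs.congr, Objective.value]
      congr 2
      · rw [← Matrix.mulVec_mulVec, ← Matrix.mulVec_mulVec, Matrix.dotProduct_mulVec y,
          Matrix.vecMul_transpose]
      · rw [Matrix.mulVec_transpose, Matrix.dotProduct_mulVec]
    rw [hx, decoupled_value_eq_sum, ← Matrix.mulVec_sub, Matrix.mulVec_mulVec, hs.mul_inv,
      Matrix.one_mulVec]
    simp only [Pi.sub_apply, (hw _).2, Finset.sum_add_distrib]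
    ring

/-! ### Parameterization of a hyperplane. -/

theorem Prog.Yields.solveForCoordinate {r : Constraint F n} (hr : r.a ≠ 0) :
    (QP.solveForCoordinate r).Yields H fun σ =>
      Set.range (fun z => σ.M *ᵥ z + σ.p) = {y | r.a ⬝ᵥ y = r.b} := by
  cases n with
  | zero => exact absurd (Subsingleton.elim _ _) hr
  | succ n =>
    refine zero.bind ?_
    rintro _ rfl
    refine one.bind ?_
    rintro _ rfl
    refine (firstNonzero _ _).bind ?_
    rintro _ (⟨-, h⟩ | ⟨j, rfl, -, hj⟩)
    · exact absurd (funext fun i => h i (List.mem_finRange i)) hr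
    refine (vec_eq (w := fun l => -(r.a (j.succAbove l) / r.a j)) fun l => ?_).bind ?_
    · refine (div _ hj).bind ?_
      rintro _ rfl
      exact neg _
    rintro _ rfl
    refine (div _ hj).bind ?_
    rintro _ rfl
    refine .ret ?_
    set M : Matrix (Fin (n + 1)) (Fin n) F := Matrix.of fun i l =>
      if i = j then -(r.a (j.succAbove l) / r.a j) else if i = j.succAbove l then 1 else 0 with hM
    set p : Fin (n + 1) → F := fun i => if i = j then r.b / r.a j else 0 with hp
    -- Coordinate `j` is solved from the equation, and the other coordinates are the free parameters
    -- `z`. Hence a point of the hyperplane is recovered from its coordinates other than `j`.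
    have h₁ (z : Fin n → F) : (M *ᵥ z + p) j =
        (r.b - ∑ l, r.a (j.succAbove l) * z l) / r.a j := by
      simp [hM, hp, Matrix.mulVec, dotProduct, sub_div, Finset.sum_div]
      rw [sub_eq_neg_add]
      congr 2
      exact Finset.sum_congr rfl fun l _ => by ring
    have h₂ (z : Fin n → F) (l : Fin n) : (M *ᵥ z + p) (j.succAbove l) = z l := by
      simp [hM, hp, Matrix.mulVec, dotProduct, Fin.succAbove_ne]
    have h₃ (z : Fin n → F) : r.a ⬝ᵥ (M *ᵥ z + p) = r.b := by
      simp only [dotProduct, Fin.sum_univ_succAbove _ j, h₁, h₂]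
      field_simp
      ring
    ext y
    constructor
    · rintro ⟨z, rfl⟩
      exact h₃ z
    · intro hy
      simp only [Set.mem_ofPred_eq, dotProduct, Fin.sum_univ_succAbove _ j] at hy
      refine ⟨fun l => y (j.succAbove l), funext fun i => ?_⟩
      rcases Fin.eq_self_or_eq_succAbove j i with rfl | ⟨l, rfl⟩
      · change (M *ᵥ _ + p) _ = _
        rw [h₁, div_eq_iff hj, ← hy]
        ring
      · exact h₂ _ l

end Lagrange

/-! ## Univariate instances -/

section Univariate

variable {F : Type u} [Field F]

theorem Objective.value_one (f : Objective F 1) (x : Fin 1 → F) :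
    f.value x = (f.Q 0 0 * x 0 + f.c 0) * x 0 + f.γ := by
  simp [Objective.value, Matrix.mulVec, dotProduct]
  ring

variable [LinearOrder F]

/-- `r` describes the minimization of `f` over `s`. -/
def Result.Solves {n : ℕ} (s : Set (Fin n → F)) (f : (Fin n → F) → F) : Result F n → Prop
  | .infeasible => s = ∅
  | .unbounded => ∀ ε, ∃ x ∈ s, f x < ε
  | .optimal val x => x ∈ s ∧ val = f x ∧ ∀ y ∈ s, f x ≤ f y

theorem Result.isCorrectFor_iff {n : ℕ} {P : Problem F n} {r : Result F n} :
    r.IsCorrectFor P ↔ r.Solves P.polyhedron P.obj.value := by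
  cases r <;> rfl

/-- The interval with the given bounds, where `none` means that there is no bound. -/
def boundedBy (lo hi : Option F) : Set F :=
  {t | (∀ s ∈ lo, s ≤ t) ∧ ∀ s ∈ hi, t ≤ s}

variable {H : Set (Handler F)}

theorem Prog.Yields.optimalAt {f : Objective F 1} {t : F} {s : Set F} (ht : t ∈ s)
    (hmin : ∀ y ∈ s, (f.Q 0 0 * t + f.c 0) * t ≤ (f.Q 0 0 * y + f.c 0) * y)
    [IsStrictOrderedRing F] :
    (QP.optimalAt f t).Yields H (Result.Solves {x | x 0 ∈ s} f.value) := by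
  refine (mul _ _).bind ?_
  rintro _ rfl
  refine (add _ _).bind ?_
  rintro _ rfl
  refine (mul _ _).bind ?_
  rintro _ rfl
  refine (add _ _).bind ?_
  rintro _ rfl
  refine .ret ⟨ht, (f.value_one fun _ => _).symm, fun y hy => ?_⟩
  simpa [Objective.value_one] using hmin _ hy

variable [IsStrictOrderedRing F]

theorem Prog.Yields.intervalBounds (l : List (Constraint F 1)) (hl : ∀ r ∈ l, r.a 0 ≠ 0)
    (lo hi : Option F) :
    (QP.intervalBounds l lo hi).Yields H fun B => ∀ t, t ∈ boundedBy B.1 B.2 ↔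
      t ∈ boundedBy lo hi ∧ ∀ r ∈ l, r.a 0 * t ≤ r.b := by
  induction l generalizing lo hi with
  | nil => exact .ret (by simp)
  | cons r l ih =>
    have ih' := ih fun r hr => hl r (by simp [hr])
    have hr := hl r (by simp)
    -- It is enough that the updated bounds describe the old interval cut by the current row alone.
    have step {lo' hi' : Option F} (h : ∀ t, t ∈ boundedBy lo' hi' ↔
        t ∈ boundedBy lo hi ∧ r.a 0 * t ≤ r.b) :
        (QP.intervalBounds l lo' hi').Yields H fun B => ∀ t, t ∈ boundedBy B.1 B.2 ↔
          t ∈ boundedBy lo hi ∧ ∀ r' ∈ r :: l, r'.a 0 * t ≤ r'.b :=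
      (ih' lo' hi').mono fun B hB t => by
        rw [hB, h, and_assoc, List.forall_mem_cons]
    refine zero.bind ?_
    rintro _ rfl
    refine (div _ hr).bind ?_
    rintro _ rfl
    refine (leTest _ _).bind fun b hb => ?_
    split_ifs with h
    · have hpos : 0 < r.a 0 := lt_of_le_of_ne (hb.1 h) hr.symm
      have hiff (t : F) : r.a 0 * t ≤ r.b ↔ t ≤ r.b / r.a 0 := by
        rw [le_div_iff₀ hpos, mul_comm]
      cases hi with
      | none => exact step fun t => by simp [boundedBy, hiff]
      | some s =>
        refine (leTest _ _).bind fun b' hb' => ?_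
        split_ifs with h'
        · refine step fun t => ?_
          have := hb'.1 h'
          simp only [boundedBy, hiff, Set.mem_ofPred_eq, Option.mem_some_iff, forall_eq']
          exact ⟨fun h => ⟨h, h.2.trans this⟩, fun h => h.1⟩
        · refine step fun t => ?_
          have := (not_le.1 fun h => h' (hb'.2 h)).le
          simp only [boundedBy, hiff, Set.mem_ofPred_eq, Option.mem_some_iff, forall_eq']
          exact ⟨fun h => ⟨⟨h.1, h.2.trans this⟩, h.2⟩, fun h => ⟨h.1.1, h.2⟩⟩
    · have hneg : r.a 0 < 0 := not_le.1 fun h0 => h (hb.2 h0)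
      have hiff (t : F) : r.a 0 * t ≤ r.b ↔ r.b / r.a 0 ≤ t := by
        rw [div_le_iff_of_neg hneg, mul_comm]
      cases lo with
      | none => exact step fun t => by simp [boundedBy, hiff, and_comm]
      | some s =>
        refine (leTest _ _).bind fun b' hb' => ?_
        split_ifs with h'
        · refine step fun t => ?_
          have := hb'.1 h'
          simp only [boundedBy, hiff, Set.mem_ofPred_eq, Option.mem_some_iff, forall_eq']
          exact ⟨fun h => ⟨h, this.trans h.1⟩, fun h => h.1⟩
        · refine step fun t => ?_
          have := (not_le.1 fun h => h' (hb'.2 h)).le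
          simp only [boundedBy, hiff, Set.mem_ofPred_eq, Option.mem_some_iff, forall_eq']
          exact ⟨fun h => ⟨⟨this.trans h.1, h.2⟩, h.1⟩, fun h => ⟨h.2, h.1.2⟩⟩

/-! ### Minimization over an interval. -/

theorem exists_ge_mul_add_lt {a : F} (ha : a < 0) (c B ε : F) : ∃ t ≥ B, a * t + c < ε := by
  -- The affine function equals `ε` at `(ε - c) / a`; one unit further it has dropped to `ε + a`.
  refine ⟨max B ((ε - c) / a + 1), le_max_left _ _, ?_⟩
  have h₁ := mul_le_mul_of_nonpos_left (le_max_right B ((ε - c) / a + 1)) ha.le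
  have h₂ : a * ((ε - c) / a + 1) = ε - c + a := by
    rw [mul_add, mul_div_cancel₀ _ ha.ne, mul_one]
  linarith

theorem exists_ge_quadratic_lt {q : F} (hq : q < 0) (c B ε : F) :
    ∃ t ≥ B, (q * t + c) * t < ε := by
  -- With the factor `q * t + c` negative and below `ε`, multiplying it by `t ≥ 1` can only decrease
  -- it.
  obtain ⟨t, ht, hlt⟩ := exists_ge_mul_add_lt hq c (max B 1) (min 0 ε)
  have h1 : 1 ≤ t := (le_max_right _ _).trans ht
  refine ⟨t, (le_max_left _ _).trans ht, ?_⟩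
  have h0 : q * t + c < 0 := hlt.trans_le (min_le_left _ _)
  have hε : q * t + c < ε := hlt.trans_le (min_le_right _ _)
  nlinarith

theorem Prog.Yields.betterOf (f : Objective F 1) (hq : f.Q 0 0 < 0) {s t : F} (hst : s ≤ t) :
    (QP.betterOf f s t).Yields H
      (Result.Solves {x | x 0 ∈ boundedBy (some s) (some t)} f.value) := by
  refine (mul _ _).bind ?_
  rintro _ rfl
  refine (add _ _).bind ?_
  rintro _ rfl
  refine (mul _ _).bind ?_
  rintro _ rfl
  refine (add _ _).bind ?_
  rintro _ rfl
  refine (mul _ _).bind ?_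
  rintro _ rfl
  refine (add _ _).bind ?_
  rintro _ rfl
  refine (mul _ _).bind ?_
  rintro _ rfl
  refine (add _ _).bind ?_
  rintro _ rfl
  -- Concavity through chord slopes: the chord from `s` to `y` has negative slope `q * (y + s) + c`,
  -- so the chord from `y` to `t`, with slope `q * (t + y) + c`, does not rise.
  have key (y : F) (hsy : s ≤ y) (hyt : y ≤ t) (h₁ : (f.Q 0 0 * y + f.c 0) * y + f.γ <
      (f.Q 0 0 * s + f.c 0) * s + f.γ) : (f.Q 0 0 * t + f.c 0) * t + f.γ ≤
      (f.Q 0 0 * y + f.c 0) * y + f.γ := by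
    have h₂ : f.Q 0 0 * (y + s) + f.c 0 < 0 := by
      by_contra! h
      nlinarith [mul_nonneg (sub_nonneg.2 hsy) h]
    have h₃ : f.Q 0 0 * (t + y) + f.c 0 ≤ 0 := by nlinarith
    nlinarith [mul_nonneg_of_nonpos_of_nonpos h₃ (sub_nonpos.2 hyt)]
  refine (leTest _ _).bind fun b hb => ?_
  split_ifs with h
  · have hle := hb.1 h
    refine .ret ⟨by simp [boundedBy, hst], (f.value_one fun _ => _).symm, fun y hy => ?_⟩
    simp only [boundedBy, Set.mem_ofPred_eq, Option.mem_some_iff, forall_eq'] at hy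
    rw [f.value_one, f.value_one]
    by_contra! hlt
    exact absurd (hle.trans (key _ hy.1 hy.2 hlt)) hlt.not_ge
  · have hlt' := not_le.1 fun h0 => h (hb.2 h0)
    refine .ret ⟨by simp [boundedBy, hst], (f.value_one fun _ => _).symm, fun y hy => ?_⟩
    simp only [boundedBy, Set.mem_ofPred_eq, Option.mem_some_iff, forall_eq'] at hy
    rw [f.value_one, f.value_one]
    rcases lt_or_ge ((f.Q 0 0 * y 0 + f.c 0) * y 0 + f.γ) ((f.Q 0 0 * s + f.c 0) * s + f.γ)
      with hlt | hge
    · exact key _ hy.1 hy.2 hlt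
    · exact hlt'.le.trans hge

theorem Prog.Yields.solveInterval (f : Objective F 1) (lo hi : Option F)
    (hne : ∀ s ∈ lo, ∀ t ∈ hi, s ≤ t) :
    (QP.solveInterval f lo hi).Yields H
      (Result.Solves {x | x 0 ∈ boundedBy lo hi} f.value) := by
  have unb (h : ∀ ε, ∃ t ∈ boundedBy lo hi, (f.Q 0 0 * t + f.c 0) * t < ε) :
      (Prog.ret .unbounded : Prog F (Result F 1)).Yields H
        (Result.Solves {x | x 0 ∈ boundedBy lo hi} f.value) := by
    refine .ret fun ε => ?_
    obtain ⟨t, ht, hlt⟩ := h (ε - f.γ)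
    refine ⟨fun _ => t, ht, ?_⟩
    rw [f.value_one]
    linarith
  refine zero.bind ?_
  rintro _ rfl
  refine (leTest _ _).bind fun b hb => ?_
  split_ifs with h
  · refine (leTest _ _).bind fun b' hb' => ?_
    split_ifs with h'
    · have hq : f.Q 0 0 = 0 := le_antisymm (hb.1 h) (hb'.1 h')
      refine (leTest _ _).bind fun b₁ hb₁ => ?_
      split_ifs with h₁
      · refine (leTest _ _).bind fun b₂ hb₂ => ?_
        split_ifs with h₂
        · have hc : f.c 0 = 0 := le_antisymm (hb₁.1 h₁) (hb₂.1 h₂)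
          match lo, hi, hne with
          | some s, hi, hne =>
            exact optimalAt ⟨by simp, fun t ht => hne s rfl t ht⟩ (by simp [hq, hc])
          | none, some t, _ => exact optimalAt ⟨by simp, by simp⟩ (by simp [hq, hc])
          | none, none, _ => exact optimalAt ⟨by simp, by simp⟩ (by simp [hq, hc])
        · have hc : f.c 0 < 0 := not_le.1 fun h0 => h₂ (hb₂.2 h0)
          cases hi with
          | some t =>
            refine optimalAt ⟨fun s hs => hne s hs t rfl, by simp⟩ fun y hy => ?_
            simpa [hq, hc] using hy.2 t rfl
          | none =>
            refine unb fun ε => ?_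
            -- The default `0` is arbitrary: without a lower bound any starting point will do.
            obtain ⟨t, ht, hlt⟩ := exists_ge_mul_add_lt hc 0 (lo.getD 0) ε
            refine ⟨t, ⟨fun s hs => ?_, by simp⟩, by simpa [hq] using hlt⟩
            rw [Option.mem_def] at hs
            simpa [hs] using ht
      · have hc : 0 < f.c 0 := not_le.1 fun h0 => h₁ (hb₁.2 h0)
        cases lo with
        | some s =>
          refine optimalAt ⟨by simp, fun t ht => hne s rfl t ht⟩ fun y hy => ?_
          simpa [hq, hc] using hy.1 s rfl
        | none =>
          refine unb fun ε => ?_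
          obtain ⟨t, ht, hlt⟩ := exists_ge_mul_add_lt (neg_lt_zero.2 hc) 0 (-hi.getD 0) ε
          refine ⟨-t, ⟨by simp, fun s hs => ?_⟩, by simpa [hq] using hlt⟩
          rw [Option.mem_def] at hs
          simp only [hs, Option.getD_some] at ht
          linarith
    · have hq : f.Q 0 0 < 0 := not_le.1 fun h0 => h' (hb'.2 h0)
      match lo, hi, hne, unb with
      | some s, some t, hne, _ => exact betterOf f hq (hne s rfl t rfl)
      | some s, none, _, unb =>
        refine unb fun ε => ?_
        obtain ⟨t, ht, hlt⟩ := exists_ge_quadratic_lt hq (f.c 0) s ε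
        exact ⟨t, ⟨by simpa using ht, by simp⟩, hlt⟩
      | none, hi, _, unb =>
        refine unb fun ε => ?_
        -- The reflection `t ↦ -t` turns the search towards minus infinity into one towards plus
        -- infinity.
        obtain ⟨t, ht, hlt⟩ := exists_ge_quadratic_lt hq (-f.c 0) (-hi.getD 0) ε
        refine ⟨-t, ⟨by simp, fun s hs => ?_⟩, by linarith⟩
        rw [Option.mem_def] at hs
        simp only [hs, Option.getD_some] at ht
        linarith
  · have hq : 0 < f.Q 0 0 := not_le.1 fun h0 => h (hb.2 h0)
    refine (add _ _).bind ?_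
    rintro _ rfl
    refine (div _ (add_pos hq hq).ne').bind ?_
    rintro _ rfl
    refine (neg _).bind ?_
    rintro _ rfl
    have hx : f.Q 0 0 * (2 * -(f.c 0 / (f.Q 0 0 + f.Q 0 0))) + f.c 0 = 0 := by
      rw [← two_mul]
      field_simp
      ring
    generalize -(f.c 0 / (f.Q 0 0 + f.Q 0 0)) = x at hx
    refine Prog.Yields.bind (post := fun x₁ => (∀ s ∈ lo, s ≤ x₁) ∧
      (x₁ = x ∨ x < x₁ ∧ x₁ ∈ lo)) ?_ fun x₁ hx₁ => ?_
    · cases lo with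
      | none => exact .ret (by simp)
      | some s =>
        refine (leTest _ _).bind fun b hb => ?_
        split_ifs with h
        · exact .ret (by simpa using hb.1 h)
        · have : x < s := not_le.1 fun h0 => h (hb.2 h0)
          exact .ret (by simpa using .inr this)
    -- The projected vertex is the vertex itself, a lower bound to its right, or an upper bound to
    -- its left.
    refine Prog.Yields.bind (post := fun x₂ => x₂ ∈ boundedBy lo hi ∧
      (x₂ = x ∨ (x < x₂ ∧ x₂ ∈ lo) ∨ (x₂ < x ∧ x₂ ∈ hi))) ?_ fun x₂ hx₂ => ?_
    · cases hi with
      | none => exact .ret ⟨⟨hx₁.1, by simp⟩, by tauto⟩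
      | some t =>
        refine (leTest _ _).bind fun b hb => ?_
        split_ifs with h
        · exact .ret ⟨⟨hx₁.1, by simpa using hb.1 h⟩, by tauto⟩
        · have ht : t < x₁ := not_le.1 fun h0 => h (hb.2 h0)
          refine .ret ⟨⟨fun s hs => hne s hs t rfl, by simp⟩, .inr (.inr ⟨?_, rfl⟩)⟩
          rcases hx₁.2 with rfl | ⟨-, hmem⟩
          · exact ht
          · exact absurd (hne _ hmem t rfl) ht.not_ge
    refine optimalAt hx₂.1 fun y hy => ?_
    -- This is the difference of the values at `y` and `x₂`, with the linear coefficient written as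
    -- `-2 * q * x`. At a bound, both factors have the same sign.
    suffices 0 ≤ (y - x₂) * (f.Q 0 0 * (y + x₂ - 2 * x)) by linear_combination this - (y - x₂) * hx
    rcases hx₂.2 with rfl | ⟨hlt, hmem⟩ | ⟨hlt, hmem⟩
    · nlinarith [mul_nonneg hq.le (sq_nonneg (y - x₂))]
    · have := hy.1 _ hmem
      exact mul_nonneg (by linarith) (mul_nonneg hq.le (by linarith))
    · have := hy.2 _ hmem
      exact mul_nonneg_of_nonpos_of_nonpos (by linarith)
        (mul_nonpos_of_nonneg_of_nonpos hq.le (by linarith))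

theorem Prog.Yields.solveLine (P : Problem F 1) (hP : ∀ r ∈ P.cons, r.a ≠ 0) :
    (QP.solveLine P).Yields H fun r => r.IsCorrectFor P := by
  refine (intervalBounds P.cons (fun r hr h0 => hP r hr ?_) none none).bind ?_
  · ext i
    rw [Fin.fin_one_eq_zero i, h0, Pi.zero_apply]
  rintro ⟨lo, hi⟩ hB
  have hpoly : P.polyhedron = {x | x 0 ∈ boundedBy lo hi} := by
    ext x
    simp only [Set.mem_ofPred_eq, hB]
    simp [Problem.polyhedron, boundedBy, dotProduct]
  simp only [Result.isCorrectFor_iff, hpoly]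
  match lo, hi with
  | some s, some t =>
    refine (leTest _ _).bind fun b hb => ?_
    split_ifs with h
    · exact solveInterval _ _ _ (by simpa using hb.1 h)
    · refine .ret (Set.eq_empty_of_forall_notMem fun x hx => h (hb.2 ?_))
      exact (hx.1 s rfl).trans (hx.2 t rfl)
  | none, hi => exact solveInterval _ _ _ (by simp)
  | some s, none => exact solveInterval _ _ _ (by simp)

/-- A local run is a run under the handler that answers nothing, so the calculus is applied to the
singleton of that handler. -/
theorem standardSubroutines_meetsSpec : (standardSubroutines F).MeetsSpec where
  diagonalize f hf := by
    obtain ⟨D, t, hr, hD⟩ := Prog.Yields.decoupledForm (H := {fun _ _ => none}) hf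
    exact ⟨D, t, hr _ rfl, hD⟩
  parameterize r hr := by
    obtain ⟨σ, t, hrun, hσ⟩ := Prog.Yields.solveForCoordinate (H := {fun _ _ => none}) hr
    exact ⟨σ, t, hrun _ rfl, hσ⟩
  solveUnivariate P hP := by
    obtain ⟨s, t, hrun, hs⟩ := Prog.Yields.solveLine (H := {fun _ _ => none}) P hP
    exact ⟨s, t, hrun _ rfl, hs⟩

end Univariate

/-! ## Reduction to the facets -/

section Geometry

variable {F : Type u} [Field F] {n : ℕ}

/-- The function `y ↦ yᵀ Λ y + uᵀ y`. -/
def separable (Λ u y : Fin n → F) : F := ∑ i, (Λ i * y i ^ 2 + u i * y i)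

theorem separable_add_single (Λ u y : Fin n → F) (i : Fin n) (t : F) :
    separable Λ u (y + Pi.single i t) =
      separable Λ u y + (Λ i * (2 * y i * t + t ^ 2) + u i * t) := by
  rw [← sub_eq_iff_eq_add', separable, separable, ← Finset.sum_sub_distrib,
    Finset.sum_eq_single i (fun j _ hj => by simp [hj]) (by simp)]
  simp
  ring

variable [LinearOrder F]

/-- The solutions of a system of linear inequalities. -/
def solutions (L : List (Constraint F n)) : Set (Fin n → F) :=
  {y | ∀ r ∈ L, r.a ⬝ᵥ y ≤ r.b}

/-- The solutions of a system of linear inequalities at which some inequality is tight. -/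
def tightSolutions (L : List (Constraint F n)) : Set (Fin n → F) :=
  {y | y ∈ solutions L ∧ ∃ r ∈ L, r.a ⬝ᵥ y = r.b}

/-- The system `diag(h) y ≤ 0`. -/
def orthantSystem (h : Fin n → Bool) : List (Constraint F n) :=
  (List.finRange n).map fun i => ⟨Pi.single i (if h i then 1 else -1), 0⟩

theorem Prog.Yields.orthantRows {H : Set (Handler F)} (h : Fin n → Bool) :
    (QP.orthantRows h : Prog F _).Yields H (· = orthantSystem h) := by
  refine zero.bind ?_
  rintro _ rfl
  refine one.bind ?_
  rintro _ rfl
  refine (neg _).bind ?_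
  rintro _ rfl
  refine .ret (List.map_congr_left fun i _ => ?_)
  congr 1
  ext j
  rw [Pi.single_apply]

variable [IsStrictOrderedRing F]

omit [IsStrictOrderedRing F] in
theorem mem_solutions_orthantSystem {h : Fin n → Bool} {y : Fin n → F} :
    y ∈ solutions (orthantSystem h) ↔ ∀ i, (if h i then 1 else -1) * y i ≤ 0 := by
  simp [solutions, orthantSystem]

theorem mem_signVectors (h : Fin n → Bool) : h ∈ signVectors n := by
  induction n with
  | zero => simp [signVectors, Subsingleton.elim h Fin.elim0]
  | succ n ih =>
    rw [signVectors, List.mem_flatMap]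
    refine ⟨Fin.tail h, ih _, ?_⟩
    cases h0 : h 0
    · simp [← h0]
    · simp [← h0]

/-- Coordinates equal to `0` could go either way; they get the sign `1`. -/
theorem exists_mem_orthant (y : Fin n → F) :
    ∃ h ∈ signVectors n, y ∈ solutions (orthantSystem h) := by
  refine ⟨fun i => decide (y i ≤ 0), mem_signVectors _, mem_solutions_orthantSystem.2 fun i => ?_⟩
  rcases le_or_gt (y i) 0 with hi | hi
  · simp [hi]
  · simp [hi.not_ge, hi.le]

/-- A ray that leaves the solution set passes through a tight solution. -/
theorem exists_first_hit {L : List (Constraint F n)} {y d : Fin n → F} (hy : y ∈ solutions L)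
    {r : Constraint F n} (hr : r ∈ L) (hd : 0 < r.a ⬝ᵥ d) :
    ∃ t : F, 0 ≤ t ∧ y + t • d ∈ tightSolutions L := by
  -- Ratio test: among the rows that increase along `d`, the one with the least quotient of slack by
  -- rate is reached first.
  obtain ⟨q, ⟨hq, hqd⟩, hmin⟩ := Set.exists_min_image {r | r ∈ L ∧ 0 < r.a ⬝ᵥ d}
    (fun r => (r.b - r.a ⬝ᵥ y) / r.a ⬝ᵥ d) (L.finite_toSet.subset fun r hr => hr.1) ⟨r, hr, hd⟩
  have hnn : 0 ≤ (q.b - q.a ⬝ᵥ y) / q.a ⬝ᵥ d := div_nonneg (sub_nonneg.2 (hy q hq)) hqd.le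
  refine ⟨_, hnn, fun r hr => ?_, q, hq, ?_⟩
  · rw [dotProduct_add, dotProduct_smul, smul_eq_mul]
    rcases le_or_gt (r.a ⬝ᵥ d) 0 with hneg | hpos
    · linarith [hy r hr, mul_nonpos_of_nonneg_of_nonpos hnn hneg]
    · have := (le_div_iff₀ hpos).1 (hmin r ⟨hr, hpos⟩)
      linarith
  · rw [dotProduct_add, dotProduct_smul, smul_eq_mul, div_mul_cancel₀ _ hqd.ne']
    ring

/-! ### Descent rays and tight points. -/

variable {Λ u : Fin n → F}

/-- A separable function without lower bound decreases without bound along some coordinate. -/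
theorem exists_descent_direction (hΛu : ∀ i, Λ i * u i = 0)
    (h : (∃ i, Λ i < 0) ∨ ∃ i, u i ≠ 0) (y : Fin n → F) :
    ∃ (i : Fin n) (s : F), (∀ t : F, 0 ≤ t → separable Λ u (y + t • Pi.single i s) ≤ separable Λ u y) ∧
      ∀ ε, ∃ t : F, 0 ≤ t ∧ separable Λ u (y + t • Pi.single i s) < ε := by
  simp only [← Pi.single_smul, smul_eq_mul, separable_add_single]
  rcases h with ⟨i, hi⟩ | ⟨i, hi⟩
  · have hu : u i = 0 := (mul_eq_zero.1 (hΛu i)).resolve_left hi.ne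
    -- Moving away from `0` makes the mixed term nonpositive, so the change is at most `Λ i * t ^
    -- 2`.
    obtain ⟨s, hs, hys⟩ : ∃ s : F, s ^ 2 = 1 ∧ 0 ≤ y i * s := by
      rcases le_total 0 (y i) with h | h
      · exact ⟨1, by simp, by simpa using h⟩
      · exact ⟨-1, by simp, by simpa using h⟩
    have hchange (t : F) (ht : 0 ≤ t) :
        Λ i * (2 * y i * (t * s) + (t * s) ^ 2) + u i * (t * s) ≤ (Λ i * t + 0) * t := by
      rw [mul_pow, hs, hu]
      nlinarith [mul_nonneg (mul_nonneg ht hys) (neg_nonneg.2 hi.le)]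
    refine ⟨i, s, fun t ht => ?_, fun ε => ?_⟩
    · nlinarith [hchange t ht, mul_nonneg (neg_nonneg.2 hi.le) (mul_nonneg ht ht)]
    · obtain ⟨t, ht, hlt⟩ := exists_ge_quadratic_lt hi 0 0 (ε - separable Λ u y)
      exact ⟨t, ht, by linarith [hchange t ht]⟩
  · have hΛ : Λ i = 0 := (mul_eq_zero.1 (hΛu i)).resolve_right hi
    have hpos : 0 < u i * u i := mul_self_pos.2 hi
    -- Along this direction the change is `-(u i * u i) * t`, whatever the sign of `u i`.
    refine ⟨i, -u i, fun t ht => ?_, fun ε => ?_⟩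
    · rw [hΛ]
      nlinarith [mul_nonneg ht hpos.le]
    · obtain ⟨t, ht, hlt⟩ := exists_ge_mul_add_lt (neg_lt_zero.2 hpos) 0 0 (ε - separable Λ u y)
      exact ⟨t, ht, by rw [hΛ]; linarith⟩

/-- In a system that contains `diag(h) y ≤ 0`, from every solution a tight one can be reached by
moving a single coordinate towards `0`, at a cost that depends on this coordinate only. -/
theorem exists_tight_le_add {L : List (Constraint F n)} {h : Fin n → Bool}
    (hL : orthantSystem h ⊆ L) {w : Fin n → F} (hw : w ∈ solutions L) (j : Fin n) :
    ∃ y ∈ tightSolutions L,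
      separable Λ u y ≤ separable Λ u w + (|Λ j| * w j ^ 2 + |u j| * |w j|) := by
  obtain ⟨σ, hσ, hrow⟩ : ∃ σ : F, σ * σ = 1 ∧ (⟨Pi.single j σ, 0⟩ : Constraint F n) ∈ L := by
    refine ⟨if h j then 1 else -1, by split_ifs <;> simp, hL ?_⟩
    exact List.mem_map.2 ⟨j, List.mem_finRange j, rfl⟩
  obtain ⟨t, ht, hy⟩ := exists_first_hit (d := Pi.single j σ) hw hrow (by simp [hσ])
  refine ⟨_, hy, ?_⟩
  have hle := hy.1 _ hrow
  simp only [single_dotProduct, Pi.add_apply, Pi.smul_apply, Pi.single_eq_same, smul_eq_mul] at hle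
  -- The endpoint still satisfies the sign row of coordinate `j`, so the move does not pass `0`.
  have hle' : t ≤ -(σ * w j) := by linear_combination hle - t * hσ
  have habs : |σ| = 1 := by
    rcases mul_self_eq_one_iff.1 hσ with rfl | rfl <;> simp
  have htw : t ≤ |w j| := hle'.trans <| (neg_le_abs _).trans <| by rw [abs_mul, habs, one_mul]
  rw [← Pi.single_smul, smul_eq_mul, separable_add_single]
  have h₁ : |2 * w j * (t * σ) + (t * σ) ^ 2| ≤ w j ^ 2 := by
    have e : (t * σ) ^ 2 = t ^ 2 := by linear_combination t ^ 2 * hσ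
    have e' : w j ^ 2 = (σ * w j) ^ 2 := by linear_combination -(w j ^ 2 * hσ)
    rw [abs_le, e, e']
    constructor
    · nlinarith [sq_nonneg (t + σ * w j)]
    · nlinarith [mul_nonneg ht (sub_nonneg.2 hle')]
  have h₂ : u j * (t * σ) ≤ |u j| * |w j| := by
    refine (le_abs_self _).trans ?_
    rw [abs_mul, abs_mul, habs, mul_one, abs_of_nonneg ht]
    exact mul_le_mul_of_nonneg_left htw (abs_nonneg _)
  have h₃ : Λ j * (2 * w j * (t * σ) + (t * σ) ^ 2) ≤ |Λ j| * w j ^ 2 := by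
    refine (le_abs_self _).trans ?_
    rw [abs_mul]
    exact mul_le_mul_of_nonneg_left h₁ (abs_nonneg _)
  linarith

/-- Unless the origin is an unconstrained minimum that satisfies the system, the objective does not
get smaller if it is restricted to the tight solutions. -/
theorem exists_tight_le_or_unbounded (hn : 2 ≤ n) (hΛu : ∀ i, Λ i * u i = 0)
    {L : List (Constraint F n)} {h : Fin n → Bool} (hL : orthantSystem h ⊆ L)
    (hopt : ¬ ((∀ i, 0 ≤ Λ i) ∧ (∀ i, u i = 0) ∧ ∀ r ∈ L, 0 ≤ r.b))
    {y : Fin n → F} (hy : y ∈ solutions L) :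
    (∃ w ∈ tightSolutions L, separable Λ u w ≤ separable Λ u y) ∨
      ∀ ε, ∃ w ∈ tightSolutions L, separable Λ u w < ε := by
  by_cases hdesc : (∃ i, Λ i < 0) ∨ ∃ i, u i ≠ 0
  · obtain ⟨i, s, hle, hunb⟩ := exists_descent_direction hΛu hdesc y
    by_cases hray : ∃ r ∈ L, 0 < r.a ⬝ᵥ Pi.single i s
    · obtain ⟨r, hr, hd⟩ := hray
      obtain ⟨t, ht, hw⟩ := exists_first_hit hy hr hd
      exact .inl ⟨_, hw, hle t ht⟩
    · push Not at hray
      right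
      intro ε
      have : Nontrivial (Fin n) := Fin.nontrivial_iff_two_le.2 hn
      obtain ⟨j, hj⟩ := exists_ne i
      -- The cost of the later move in coordinate `j` is reserved in advance; it can be computed at
      -- `y` because the ray leaves coordinate `j` fixed.
      obtain ⟨t, ht, hlt⟩ := hunb (ε - (|Λ j| * y j ^ 2 + |u j| * |y j|))
      have hsol : y + t • Pi.single i s ∈ solutions L := fun r hr => by
        rw [dotProduct_add, dotProduct_smul, smul_eq_mul]
        linarith [hy r hr, mul_nonpos_of_nonneg_of_nonpos ht (hray r hr)]
      obtain ⟨w, hw, hle'⟩ := exists_tight_le_add (Λ := Λ) (u := u) hL hsol j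
      simp only [Pi.add_apply, Pi.smul_apply, Pi.single_eq_of_ne hj, smul_zero, add_zero] at hle'
      exact ⟨w, hw, by linarith⟩
  · push Not at hdesc
    obtain ⟨r, hr, hb⟩ : ∃ r ∈ L, r.b < 0 := by
      by_contra! hb
      exact hopt ⟨hdesc.1, hdesc.2, hb⟩
    have hry : r.a ⬝ᵥ y < 0 := (hy r hr).trans_lt hb
    -- Walking towards the origin must stop before `t = 1`, since row `r` fails there; the point
    -- reached is `(1 - t) • y`, whose squares are no larger.
    obtain ⟨t, ht, hw⟩ := exists_first_hit (d := -y) hy hr (by simpa using hry)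
    refine .inl ⟨_, hw, ?_⟩
    have hrw := (hw.1 r hr).trans_lt hb
    rw [dotProduct_add, dotProduct_smul, dotProduct_neg, smul_eq_mul] at hrw
    have ht1 : t < 1 := by
      by_contra! h1
      nlinarith
    simp only [separable]
    refine Finset.sum_le_sum fun i _ => ?_
    simp only [hdesc.2, Pi.add_apply, Pi.smul_apply, Pi.neg_apply, smul_eq_mul, zero_mul, add_zero]
    refine mul_le_mul_of_nonneg_left ?_ (hdesc.1 i)
    have : (y i + t * -y i) ^ 2 = (1 - t) ^ 2 * y i ^ 2 := by ring
    rw [this]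
    exact mul_le_of_le_one_left (sq_nonneg _) (pow_le_one₀ (by linarith) (by linarith))

end Geometry

/-! ## Correctness of the algorithm -/

section Correctness

variable {F : Type u} [Field F] [LinearOrder F] {H : Set (Handler F)} {n : ℕ}

/-! ### Facets, candidates and the auxiliary procedures. -/

theorem mem_picks {α : Type u} {L : List α} {q : α × List α} (hq : q ∈ picks L) (r : α) :
    r ∈ L ↔ r = q.1 ∨ r ∈ q.2 := by
  induction L generalizing q with
  | nil => simp [picks] at hq
  | cons a l ih =>
    rw [picks, List.mem_cons, List.mem_map] at hq
    rcases hq with rfl | ⟨q, hq, rfl⟩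
    · simp
    · rw [List.mem_cons, ih hq, List.mem_cons]
      tauto

theorem exists_mem_picks {α : Type u} {L : List α} {r : α} (hr : r ∈ L) :
    ∃ q ∈ picks L, q.1 = r := by
  induction L with
  | nil => simp at hr
  | cons a l ih =>
    rcases List.mem_cons.1 hr with rfl | hr
    · exact ⟨(r, l), by simp [picks], rfl⟩
    · obtain ⟨q, hq, rfl⟩ := ih hr
      refine ⟨(q.1, a :: q.2), ?_, rfl⟩
      simp only [picks, List.mem_cons, List.mem_map]
      exact .inr ⟨q, hq, rfl⟩

/-- The points with `aᵀ y = b` for the first component and `aᵀ y ≤ b` for the others. -/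
def facet (q : Constraint F n × List (Constraint F n)) : Set (Fin n → F) :=
  {y | q.1.a ⬝ᵥ y = q.1.b ∧ y ∈ solutions q.2}

theorem mem_tightSolutions_iff {L : List (Constraint F n)} {y : Fin n → F} :
    y ∈ tightSolutions L ↔ ∃ q ∈ picks L, y ∈ facet q := by
  constructor
  · rintro ⟨hy, r, hr, he⟩
    obtain ⟨q, hq, rfl⟩ := exists_mem_picks hr
    exact ⟨q, hq, he, fun r hr' => hy r ((mem_picks hq r).2 (.inr hr'))⟩
  · rintro ⟨q, hq, he, hy⟩
    refine ⟨fun r hr => ?_, q.1, (mem_picks hq _).2 (.inl rfl), he⟩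
    rcases (mem_picks hq r).1 hr with rfl | hr
    · exact he.le
    · exact hy r hr

/-- The candidates are points of `X` together with their values, and the minimum of `φ` over `Y` is
not smaller than that over the candidates. -/
structure IsCandidateList (φ : (Fin n → F) → F) (X Y : Set (Fin n → F))
    (cand : List (F × (Fin n → F))) : Prop where
  sound : ∀ c ∈ cand, c.2 ∈ X ∧ c.1 = φ c.2
  complete : ∀ y ∈ Y, ∃ c ∈ cand, c.1 ≤ φ y

theorem Prog.Yields.dropZeroRows (L : List (Constraint F n)) :
    (QP.dropZeroRows L).Yields H fun o => (o = none ∧ solutions L = ∅) ∨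
      ∃ L', o = some L' ∧ (∀ r ∈ L', r.a ≠ 0) ∧ solutions L = solutions L' := by
  induction L with
  | nil => exact .ret (.inr ⟨[], rfl, by simp, rfl⟩)
  | cons r l ih =>
    have hcons (y : Fin n → F) :
        y ∈ solutions (r :: l) ↔ r.a ⬝ᵥ y ≤ r.b ∧ y ∈ solutions l := List.forall_mem_cons
    refine (allTest fun i _ => zeroTest _).bind fun b hb => ?_
    split_ifs with h
    · have ha : r.a = 0 := funext fun i => hb.1 h i (List.mem_finRange i)
      simp only [ha, zero_dotProduct] at hcons
      refine zero.bind ?_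
      rintro _ rfl
      refine (leTest _ _).bind fun b' hb' => ?_
      split_ifs with h'
      · have : solutions (r :: l) = solutions l :=
          Set.ext fun y => (hcons y).trans (and_iff_right (hb'.1 h'))
        rwa [this]
      · exact .ret (.inl ⟨rfl, Set.eq_empty_of_forall_notMem fun y hy =>
          h' (hb'.2 ((hcons y).1 hy).1)⟩)
    · refine ih.bind ?_
      rintro _ (⟨rfl, he⟩ | ⟨L', rfl, hL', he⟩)
      · refine .ret (.inl ⟨rfl, Set.eq_empty_of_forall_notMem fun y hy => ?_⟩)
        exact Set.notMem_empty y (he ▸ ((hcons y).1 hy).2)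
      · refine .ret (.inr ⟨r :: L', rfl, List.forall_mem_cons.2 ⟨?_, hL'⟩, ?_⟩)
        · intro h0
          exact h (hb.2 fun i _ => congrFun h0 i)
        · ext y
          rw [hcons, he]
          exact (List.forall_mem_cons (p := fun q : Constraint F n => q.a ⬝ᵥ y ≤ q.b)).symm

theorem Prog.Yields.selectMin (best : F × (Fin n → F)) (l : List (F × (Fin n → F))) :
    (QP.selectMin best l).Yields H fun c => c ∈ best :: l ∧ ∀ q ∈ best :: l, c.1 ≤ q.1 := by
  induction l generalizing best with
  | nil => exact .ret (by simp)
  | cons q l ih =>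
    refine (leTest _ _).bind fun b hb => ?_
    split_ifs with h
    · refine (ih best).mono ?_
      rintro c ⟨hc, hmin⟩
      simp only [List.mem_cons, forall_eq_or_imp] at hc hmin ⊢
      exact ⟨by tauto, hmin.1, hmin.1.trans (hb.1 h), hmin.2⟩
    · have hlt := not_le.1 fun h0 => h (hb.2 h0)
      refine (ih q).mono ?_
      rintro c ⟨hc, hmin⟩
      simp only [List.mem_cons, forall_eq_or_imp] at hc hmin ⊢
      exact ⟨by tauto, hmin.1.trans hlt.le, hmin.1, hmin.2⟩

theorem Prog.Yields.globalTest (D : Decomposition F n) (L : List (Constraint F n)) :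
    (QP.globalTest D L).Yields H fun b => b.down = true ↔
      (∀ i, 0 ≤ D.Λ i) ∧ (∀ i, D.u i = 0) ∧ ∀ r ∈ L, 0 ≤ r.b := by
  refine zero.bind ?_
  rintro _ rfl
  refine (allTest fun i _ => leTest _ _).bind fun b₁ hb₁ => ?_
  simp only [List.mem_finRange, true_imp_iff] at hb₁
  rw [← hb₁]
  split_ifs with h₁
  · refine (allTest fun i _ => zeroTest _).bind fun b₂ hb₂ => ?_
    simp only [List.mem_finRange, true_imp_iff] at hb₂
    rw [← hb₂]
    split_ifs with h₂
    · refine (allTest fun i _ => leTest _ _).mono fun b₃ hb₃ => ?_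
      simp only [List.mem_finRange, true_imp_iff] at hb₃
      simp [hb₃, h₁, h₂, List.forall_mem_iff_get]
    · exact .ret (by simp [h₂])
  · exact .ret (by simp [h₁])

variable [IsStrictOrderedRing F]

theorem Prog.Yields.symmetrize (f : Objective F n) :
    (QP.symmetrize f).Yields H fun g => g.Q.IsSymm ∧ g.value = f.value := by
  refine one.bind ?_
  rintro _ rfl
  refine (add _ _).bind ?_
  rintro _ rfl
  have h2 : (1 + 1 : F) ≠ 0 := by rw [one_add_one_eq_two]; exact two_ne_zero
  refine (mat (M := (1 + 1 : F)⁻¹ • (f.Q + f.Qᵀ)) fun i j => ?_).bind ?_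
  · refine (add _ _).bind ?_
    rintro _ rfl
    exact (div _ h2).mono fun a ha => by simp [ha, div_eq_inv_mul]
  rintro _ rfl
  refine .ret ⟨?_, funext fun x => ?_⟩
  · simp [Matrix.IsSymm, add_comm]
  · have : x ⬝ᵥ (f.Qᵀ *ᵥ x) = x ⬝ᵥ (f.Q *ᵥ x) := by
      rw [Matrix.mulVec_transpose, dotProduct_comm, Matrix.dotProduct_mulVec]
    simp only [Objective.value, Matrix.smul_mulVec, dotProduct_smul, Matrix.add_mulVec,
      dotProduct_add, this, smul_eq_mul]
    field_simp

omit [IsStrictOrderedRing F] in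
theorem Prog.Yields.decomposition_objective (D : Decomposition F n) :
    D.objective.Yields H fun f => ∀ y, f.value y = separable D.Λ D.u y + D.γ := by
  refine zero.bind ?_
  rintro _ rfl
  refine .ret fun y => ?_
  have h1 : (Matrix.of fun i j => if i = j then D.Λ i else 0) = Matrix.diagonal D.Λ := rfl
  have := decoupled_value_eq_sum 1 D.Λ D.u y
  simp only [Matrix.transpose_one, Matrix.one_mul, Matrix.mul_one, Matrix.one_mulVec] at this
  rw [Objective.value, h1, this, separable]

/-! ### Branching and recursion. -/

variable {R : Subroutines F} (hR : R.MeetsSpec)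

include hR

/-- The parameterization is onto the hyperplane, so the polyhedron of the recursive instance is the
preimage of the facet and covers all of it. `Y` collects what earlier iterations have covered, and a
single optimal candidate covers a whole facet. -/
theorem Prog.Yields.facetLoop
    (hrec : ∀ P : Problem F (n - 1), (Prog.recurse P).Yields H fun r => r.IsCorrectFor P)
    (f : Objective F n) {X Y : Set (Fin n → F)}
    (l : List (Constraint F n × List (Constraint F n))) (hl : ∀ q ∈ l, q.1.a ≠ 0)
    (hX : ∀ q ∈ l, facet q ⊆ X) {cand : List (F × (Fin n → F))}
    (hcand : IsCandidateList f.value X Y cand) :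
    (QP.facetLoop R f l cand).Yields H fun o =>
      (o = none ∧ ∀ ε, ∃ y ∈ X, f.value y < ε) ∨
      ∃ cand', o = some cand' ∧
        IsCandidateList f.value X (Y ∪ {y | ∃ q ∈ l, y ∈ facet q}) cand' := by
  induction l generalizing Y cand with
  | nil => exact .ret (.inr ⟨cand, rfl, by simpa using hcand⟩)
  | cons q l ih =>
    obtain ⟨row, rest⟩ := q
    have hunion : Y ∪ {y | ∃ q ∈ (row, rest) :: l, y ∈ facet q} =
        (Y ∪ facet (row, rest)) ∪ {y | ∃ q ∈ l, y ∈ facet q} := by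
      ext y
      simp [or_assoc]
    rw [hunion]
    have ih' {cand'} (h : IsCandidateList f.value X (Y ∪ facet (row, rest)) cand') :=
      ih (fun q hq => hl q (by simp [hq])) (fun q hq => hX q (by simp [hq])) h
    obtain ⟨σ', s, hrun, hσ⟩ := hR.parameterize row (hl (row, rest) (by simp))
    refine (of_runLocal (post := (· = σ')) hrun rfl).bind ?_
    rintro σ rfl
    refine (mapList_eq fun r _ => constraint_subst σ r).bind ?_
    rintro _ rfl
    refine (objective_subst σ f).bind fun g hg => ?_
    have hmem (z : Fin (n - 1) → F) :
        z ∈ Problem.polyhedron ⟨rest.map (Constraint.pullback σ), g⟩ ↔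
          σ.M *ᵥ z + σ.p ∈ facet (row, rest) := by
      have : row.a ⬝ᵥ (σ.M *ᵥ z + σ.p) = row.b := hσ.subset ⟨z, rfl⟩
      simp [Problem.polyhedron, facet, this, solutions, Constraint.pullback_le_iff]
    have hsurj {y : Fin n → F} (hy : y ∈ facet (row, rest)) : ∃ z, σ.M *ᵥ z + σ.p = y :=
      hσ.superset hy.1
    have hX' : facet (row, rest) ⊆ X := hX _ (by simp)
    refine (hrec _).bind ?_
    rintro (_ | _ | ⟨val, z⟩) hr
    · refine ih' ⟨hcand.sound, ?_⟩
      rintro y (hy | hy)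
      · exact hcand.complete y hy
      · obtain ⟨z, rfl⟩ := hsurj hy
        exact absurd ((hmem z).2 hy) (hr ▸ Set.notMem_empty z)
    · refine .ret (.inl ⟨rfl, fun ε => ?_⟩)
      obtain ⟨z, hz, hlt⟩ := hr ε
      exact ⟨_, hX' ((hmem z).1 hz), hg z ▸ hlt⟩
    · obtain ⟨hz, hval, hmin⟩ := hr
      refine (apply _ _).bind ?_
      rintro _ rfl
      refine ih' ⟨List.forall_mem_cons.2 ⟨⟨hX' ((hmem z).1 hz), hval.trans (hg z)⟩, hcand.sound⟩,
        ?_⟩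
      rintro y (hy | hy)
      · obtain ⟨c, hc, hle⟩ := hcand.complete y hy
        exact ⟨c, by simp [hc], hle⟩
      · obtain ⟨z', rfl⟩ := hsurj hy
        refine ⟨_, List.mem_cons_self, ?_⟩
        rw [← hg]
        exact hval.trans_le (hmin z' ((hmem z').2 hy))

theorem Prog.Yields.orthantLoop
    (hrec : ∀ P : Problem F (n - 1), (Prog.recurse P).Yields H fun r => r.IsCorrectFor P)
    (f : Objective F n) {L : List (Constraint F n)} (hL : ∀ r ∈ L, r.a ≠ 0)
    {Y : Set (Fin n → F)} (l : List (Fin n → Bool)) {cand : List (F × (Fin n → F))}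
    (hcand : IsCandidateList f.value (solutions L) Y cand) :
    (QP.orthantLoop R f L l cand).Yields H fun o =>
      (o = none ∧ ∀ ε, ∃ y ∈ solutions L, f.value y < ε) ∨
      ∃ cand', o = some cand' ∧ IsCandidateList f.value (solutions L)
        (Y ∪ {y | ∃ h ∈ l, y ∈ tightSolutions (L ++ orthantSystem h)}) cand' := by
  induction l generalizing Y cand with
  | nil => exact .ret (.inr ⟨cand, rfl, by simpa using hcand⟩)
  | cons h l ih =>
    refine (orthantRows h).bind ?_
    rintro _ rfl
    refine (facetLoop hR hrec f (X := solutions L) _ (fun q hq => ?_) (fun q hq y hy r hr => ?_)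
      hcand).bind ?_
    · rcases List.mem_append.1 ((mem_picks hq q.1).2 (.inl rfl)) with hr | hr
      · exact hL _ hr
      · obtain ⟨i, -, hi⟩ := List.mem_map.1 hr
        rw [← hi]
        change Pi.single i _ ≠ 0
        rw [Ne, Pi.single_eq_zero_iff]
        split_ifs <;> simp
    · exact (mem_tightSolutions_iff.2 ⟨q, hq, hy⟩).1 r (by simp [hr])
    · rintro _ (⟨rfl, hunb⟩ | ⟨cand', rfl, hcand'⟩)
      · exact .ret (.inl ⟨rfl, hunb⟩)
      · have hunion : Y ∪ {y | ∃ h' ∈ h :: l, y ∈ tightSolutions (L ++ orthantSystem h')} =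
            (Y ∪ {y | ∃ q ∈ picks (L ++ orthantSystem h), y ∈ facet q}) ∪
              {y | ∃ h' ∈ l, y ∈ tightSolutions (L ++ orthantSystem h')} := by
          ext y
          simp [or_assoc, mem_tightSolutions_iff]
        rw [hunion]
        exact ih hcand'

theorem Prog.Yields.solveMultivariate (hn : n ≠ 1)
    (hrec : 2 ≤ n → ∀ P : Problem F (n - 1), (Prog.recurse P).Yields H fun r => r.IsCorrectFor P)
    (P : Problem F n) (hP : ∀ r ∈ P.cons, r.a ≠ 0) :
    (QP.solveMultivariate R P).Yields H fun r => r.IsCorrectFor P := by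
  refine (symmetrize P.obj).bind ?_
  rintro g ⟨hgsymm, hg⟩
  obtain ⟨D', s, hrun, hD⟩ := hR.diagonalize g hgsymm
  refine (of_runLocal (post := (· = D')) hrun rfl).bind ?_
  rintro D rfl
  refine (mapList_eq fun r _ => constraint_subst _ r).bind ?_
  rintro _ rfl
  refine (decomposition_objective D).bind fun f hf => ?_
  have hinv : D.Sinv * D.S = 1 := mul_eq_one_comm.1 hD.mul_inv
  have hvalue (y : Fin n → F) : P.obj.value (D.Sinv *ᵥ y + D.v) = f.value y := by
    rw [← hg, hD.value_eq, decoupled_value_eq_sum, add_sub_cancel_right, Matrix.mulVec_mulVec,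
      hD.mul_inv, Matrix.one_mulVec, hf, separable]
  have hsurj (x : Fin n → F) : ∃ y, D.Sinv *ᵥ y + D.v = x :=
    ⟨D.S *ᵥ (x - D.v), by simp [hinv]⟩
  set L := P.cons.map (Constraint.pullback ⟨D.Sinv, D.v⟩) with hLdef
  have hmem (y : Fin n → F) : y ∈ solutions L ↔ D.Sinv *ᵥ y + D.v ∈ P.polyhedron := by
    simp [hLdef, solutions, Problem.polyhedron, Constraint.pullback_le_iff]
  -- An invertible change of coordinates creates no zero rows, so every row defines a hyperplane.
  have hL : ∀ r ∈ L, r.a ≠ 0 := by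
    intro r hr h0
    obtain ⟨q, hq, rfl⟩ := List.mem_map.1 hr
    refine hP q hq ?_
    have : (q.a ᵥ* D.Sinv) ᵥ* D.S = 0 ᵥ* D.S := congrArg (· ᵥ* D.S) h0
    simpa [Matrix.vecMul_vecMul, hinv] using this
  refine (globalTest D L).bind fun b hb => ?_
  split_ifs with h
  · obtain ⟨hΛ, hu, hb⟩ := hb.1 h
    have hv : D.Sinv *ᵥ 0 + D.v = D.v := by simp
    have h0 : f.value 0 = D.γ := by simp [hf, separable]
    refine .ret ⟨?_, ?_, fun x _ => ?_⟩
    · rw [← hv, ← hmem]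
      exact fun r hr => by simpa using hb r hr
    · rw [← h0, ← hvalue, hv]
    · obtain ⟨y, rfl⟩ := hsurj x
      nth_rw 1 [← hv]
      rw [hvalue, hvalue, h0, hf, separable, le_add_iff_nonneg_left]
      exact Finset.sum_nonneg fun i _ => by
        rw [hu, zero_mul, add_zero]
        exact mul_nonneg (hΛ i) (sq_nonneg _)
  · have hopt := fun h' => h (hb.2 h')
    -- In dimension `0` a non-zero row cannot exist, so the global check would have succeeded.
    have hn2 : 2 ≤ n := by
      rcases Nat.eq_zero_or_pos n with rfl | hpos
      · exact absurd ⟨fun i => i.elim0, fun i => i.elim0,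
          fun r hr => absurd (Subsingleton.elim _ _) (hL r hr)⟩ hopt
      · omega
    refine (orthantLoop hR (hrec hn2) f hL (signVectors n) (Y := ∅) (cand := [])
      ⟨by simp, by simp⟩).bind ?_
    rintro _ (⟨rfl, hunb⟩ | ⟨cand, rfl, hsound, hcomplete⟩)
    · refine .ret fun ε => ?_
      obtain ⟨y, hy, hlt⟩ := hunb ε
      exact ⟨_, (hmem y).1 hy, (hvalue y).trans_lt hlt⟩
    have hΛu (i : Fin n) : D.Λ i * D.u i = 0 := by
      simpa [Matrix.mulVec_diagonal] using congrFun hD.decoupled i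
    have hcover : ∀ y ∈ solutions L, ∃ c ∈ cand, c.1 ≤ f.value y := by
      intro y hy
      obtain ⟨h, hh, hyh⟩ := exists_mem_orthant y
      have hcomplete' : ∀ w ∈ tightSolutions (L ++ orthantSystem h), ∃ c ∈ cand, c.1 ≤ f.value w :=
        fun w hw => hcomplete w (.inr ⟨h, hh, hw⟩)
      have hy' : y ∈ solutions (L ++ orthantSystem h) :=
        List.forall_mem_append.2 ⟨hy, hyh⟩
      rcases exists_tight_le_or_unbounded hn2 hΛu (List.subset_append_right _ _)
        (fun h' => hopt ⟨h'.1, h'.2.1, fun r hr => h'.2.2 r (by simp [hr])⟩) hy'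
        with ⟨w, hw, hle⟩ | hunb
      · obtain ⟨c, hc, hcw⟩ := hcomplete' w hw
        exact ⟨c, hc, hcw.trans (by rw [hf, hf]; linarith)⟩
      -- Unboundedness on the tight points is impossible here: they are all bounded below by the
      -- least of finitely many candidates. The value `0` only serves to produce one tight point,
      -- hence one candidate.
      · obtain ⟨w₀, hw₀, -⟩ := hunb 0
        obtain ⟨c₀, hc₀, -⟩ := hcomplete' w₀ hw₀
        obtain ⟨c, -, hmin⟩ := Set.exists_min_image {c | c ∈ cand} Prod.fst cand.finite_toSet
          ⟨c₀, hc₀⟩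
        obtain ⟨w, hw, hlt⟩ := hunb (c.1 - D.γ)
        obtain ⟨c', hc', hle⟩ := hcomplete' w hw
        have := hmin c' hc'
        rw [hf] at hle
        linarith
    cases cand with
    | nil =>
      refine .ret (Set.eq_empty_of_forall_notMem fun x hx => ?_)
      obtain ⟨y, rfl⟩ := hsurj x
      obtain ⟨c, hc, -⟩ := hcover y ((hmem y).2 hx)
      simp at hc
    | cons q l =>
      refine (selectMin q l).bind ?_
      rintro c ⟨hc, hmin⟩
      refine (apply _ _).bind ?_
      rintro _ rfl
      obtain ⟨hcL, hval⟩ := hsound c hc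
      refine .ret ⟨(hmem _).1 hcL, hval.trans (hvalue _).symm, fun x hx => ?_⟩
      obtain ⟨y, rfl⟩ := hsurj x
      obtain ⟨c', hc', hle⟩ := hcover y ((hmem y).2 hx)
      rw [hvalue, hvalue]
      exact hval.symm.trans_le ((hmin c' hc').trans hle)

theorem Prog.Yields.minQP
    (hrec : 2 ≤ n → ∀ P : Problem F (n - 1), (Prog.recurse P).Yields H fun r => r.IsCorrectFor P)
    (P : Problem F n) : (QP.minQP R P).Yields H fun r => r.IsCorrectFor P := by
  refine (dropZeroRows P.cons).bind ?_
  rintro _ (⟨rfl, he⟩ | ⟨L, rfl, hL, he⟩)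
  · exact .ret he
  have hiff (r : Result F n) : r.IsCorrectFor ⟨L, P.obj⟩ ↔ r.IsCorrectFor P := by
    have hpoly : P.polyhedron = Problem.polyhedron ⟨L, P.obj⟩ := he
    rw [Result.isCorrectFor_iff, Result.isCorrectFor_iff, hpoly]
  simp only [← hiff]
  match n, P, L, hL, hrec with
  | 0, P, L, hL, hrec => exact solveMultivariate hR (by simp) hrec _ hL
  | 1, P, L, hL, hrec =>
    obtain ⟨r, s, hrun, hr⟩ := hR.solveUnivariate ⟨L, P.obj⟩ hL
    exact of_runLocal hrun hr
  | n + 2, P, L, hL, hrec => exact solveMultivariate hR (by simp) hrec _ hL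

/-- Each nested call lowers the dimension, and dimension `0` makes no call, so depth `n + 1`
suffices. Using all deeper executions as handlers at once makes result and step count independent of
the depth. -/
theorem exists_exec_eq (n : ℕ) (P : Problem F n) :
    ∃ r s, (∀ d ≥ n + 1, exec R d n P = some (r, s)) ∧ r.IsCorrectFor P := by
  induction n with
  | zero =>
    obtain ⟨r, s, hrun, hr⟩ :=
      Prog.Yields.minQP (H := {h | ∃ d ≥ 0, h = exec R d}) hR (by simp) P
    refine ⟨r, s, fun d hd => ?_, hr⟩
    obtain ⟨d, rfl⟩ := Nat.exists_eq_add_of_le' hd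
    exact hrun _ ⟨d, by simp, rfl⟩
  | succ n ih =>
    have hrec (P : Problem F n) : (Prog.recurse P).Yields {h | ∃ d ≥ n + 1, h = exec R d}
        fun r => r.IsCorrectFor P := by
      obtain ⟨r, s, hexec, hr⟩ := ih P
      -- The `1` is the call instruction itself, the `0` the free return after it.
      refine ⟨r, s + 0 + 1, ?_, hr⟩
      rintro _ ⟨d, hd, rfl⟩
      rw [Prog.recurse, Prog.run, hexec d hd]
      rfl
    obtain ⟨r, s, hrun, hr⟩ := Prog.Yields.minQP (n := n + 1) hR (fun _ => hrec) P
    refine ⟨r, s, fun d hd => ?_, hr⟩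
    obtain ⟨d, rfl⟩ := Nat.exists_eq_add_of_le' hd
    exact hrun _ ⟨d + (n + 1), by simp, rfl⟩

end Correctness

end QP

/-! ### The main theorem. -/

theorem mainTheorem2 {F : Type*} [Field F] [LinearOrder F] [IsStrictOrderedRing F] :
    -- the explicit subroutines meet their specification, and
    (QP.standardSubroutines F).MeetsSpec ∧
    -- the algorithm is correct for all subroutines that meet it
    ∀ R : QP.Subroutines F, R.MeetsSpec →
      ∀ {m n : ℕ} (A : Matrix (Fin m) (Fin n) F) (b : Fin m → F)
        (Q : Matrix (Fin n) (Fin n) F) (c : Fin n → F) (γ : F)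
        (P : Set (Fin n → F)) (f : (Fin n → F) → F),
        P = {x | A *ᵥ x ≤ b} → (∀ x, f x = x ⬝ᵥ (Q *ᵥ x) + c ⬝ᵥ x + γ) →
        ∃ (steps : ℕ) (r : QP.Result F n),
          QP.Halts R (QP.Problem.ofMatrix A b Q c γ) steps r ∧
          (r = .infeasible ↔ P = ∅) ∧
          (r = .unbounded ↔ ∀ ε : F, ∃ x ∈ P, f x < ε) ∧
          ((∃ val x, r = .optimal val x) ↔ ∃ x ∈ P, ∀ y ∈ P, f x ≤ f y) ∧
          (∀ val x, r = .optimal val x → x ∈ P ∧ val = f x ∧ ∀ y ∈ P, f x ≤ f y) := by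
  refine ⟨QP.standardSubroutines_meetsSpec, fun R hR m n A b Q c γ P f hP hf => ?_⟩
  obtain ⟨r, s, hexec, hr⟩ := QP.exists_exec_eq hR n (QP.Problem.ofMatrix A b Q c γ)
  have hpoly : (QP.Problem.ofMatrix A b Q c γ).polyhedron = P := by
    ext x
    simp [hP, QP.Problem.polyhedron, QP.Problem.ofMatrix, Pi.le_def, Matrix.mulVec]
  have hval : (QP.Problem.ofMatrix A b Q c γ).obj.value = f := funext fun x => (hf x).symm
  rw [QP.Result.isCorrectFor_iff, hpoly, hval] at hr
  refine ⟨s, r, ⟨n + 1, hexec⟩, ?_⟩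
  -- Emptiness, unboundedness and existence of a minimum exclude one another, so correctness of the
  -- returned answer already gives all the equivalences.
  rcases r with _ | _ | ⟨val, x⟩
  · have hr : P = ∅ := hr
    simp [hr]
  · have hr : ∀ ε : F, ∃ x ∈ P, f x < ε := hr
    have hne : P ≠ ∅ := by
      obtain ⟨x, hx, -⟩ := hr 0
      exact Set.nonempty_iff_ne_empty.1 ⟨x, hx⟩
    refine ⟨by simp [hne], by simpa using hr, ?_, by simp⟩
    simp only [reduceCtorEq, exists_false, false_iff]
    rintro ⟨x, -, hmin⟩
    obtain ⟨y, hy, hlt⟩ := hr (f x)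
    exact (hmin y hy).not_gt hlt
  · obtain ⟨hx, hv, hmin⟩ : x ∈ P ∧ val = f x ∧ ∀ y ∈ P, f x ≤ f y := hr
    have hne : P ≠ ∅ := Set.nonempty_iff_ne_empty.1 ⟨x, hx⟩
    refine ⟨by simp [hne], ?_, ⟨fun _ => ⟨x, hx, hmin⟩, fun _ => ⟨val, x, rfl⟩⟩, ?_⟩
    · simp only [reduceCtorEq, false_iff]
      intro h
      obtain ⟨y, hy, hlt⟩ := h (f x)
      exact (hmin y hy).not_gt hlt
    · rintro _ _ ⟨⟩
      exact ⟨hx, hv, hmin⟩
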